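/- Let $\Sigma\subset\mathbb{C}$ be a compact set of positive logarithmic capacity, let $h$ be a real function that is harmonic in a neighbourhood of $\Sigma$, let $\Delta>0$, and put $Q(z)=\Delta|z|^2+h(z)$ for $z\in\Sigma$ and $Q(z)=+\infty$ for $z\notin\Sigma$. Write $dA=\frac1\pi\,dx\,dy$. Let $\sigma$ be the equilibrium measure, i.e. the minimizer of $$I_Q[\mu]=\iint\log\frac1{|z-w|}\,d\mu(z)\,d\mu(w)+\int Q\,d\mu$$ over all compactly supported Borel probability measures $\mu$ on $\mathbb{C}$, and let $S=\operatorname{supp}\sigma$ be the droplet. Let the obstacle function $\check Q(z)$ be the supremum of $s(z)$ over all subharmonic functions $s$ on $\mathbb{C}$ with $s\le Q$ on $\mathbb{C}$ and $s(w)\le 2\log|w|+O(1)$ as $w\to\infty$, and put $Q_{\mathrm{eff}}=Q-\check Q$. For an integer $n\ge1$ and $\beta>0$ let $\mathbb{P}_n^\beta$ be the probability measure on $\mathbb{C}^n$ with density proportional to $e^{-\beta H_n}$ with respect to $dA^{\otimes n}$, where $$H_n(z_1,\dots,z_n)=\sum_{i\ne j}\log\frac1{|z_i-z_j|}+n\sum_{i=1}^nQ(z_i),$$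 and let $$R_n^\beta(p)=\limsup_{\varepsilon\to0+}\frac1{\varepsilon^2}\,\mathbb{E}_n^\beta\big[\#\{i: |z_i-p|\le\varepsilon\}\big]$$ be the one-point function (the upper limit equals the limit wherever the limit exists). Theorem (Upper bound). For all $\Delta_0>0$ and $\eta_0>0$ there is a constant $C=C(\Delta_0,\eta_0)>0$ such that the following holds. Let $\Sigma$, $h$, $\Delta$ be as above, and assume that $\Delta\ge\Delta_0$, that $|z-w|\ge2\eta_0$ for all $z\in S$ and $w\in\mathbb{C}\setminus\Sigma$, and that $\{z\in\mathbb{C}: Q(z)=\check Q(z)\}=S$. Then for all $n\ge1$, all $\beta>0$ and all $z\in\mathbb{C}$, $$R_n^\beta(z)\le C^\beta(1+\beta^{-2})\,n\Delta\,\min\{1,\;n e^{-n\beta Q_{\mathrm{eff}}(z)}\},$$ where $e^{-\infty}=0$. -/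

import Mathlib

open MeasureTheory Filter Topology
open scoped ENNReal

namespace HeleShaw

noncomputable section

/-- The quasi-harmonic (Hele-Shaw) potential: `Δ |z|² + h z` on `Sig` and `+∞` elsewhere. -/
def potential (Sig : Set ℂ) (Δ : ℝ) (h : ℂ → ℝ) (z : ℂ) : EReal :=
  open Classical in
  if z ∈ Sig then ((Δ * ‖z‖ ^ 2 + h z : ℝ) : EReal) else ⊤

/-- The kernel `log (1 / |z - w|)`, with value `+∞` on the diagonal. -/
def logKernel (z w : ℂ) : EReal := -ENNReal.log (edist z w)

/-! ### Equilibrium measure and droplet -/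

/-- The integral `∫ f⁺ dμ - ∫ f⁻ dμ` of an extended real valued function. It is only used for
functions that are bounded below on a set of full measure, with `μ` finite. -/
def extIntegral {α : Type*} [MeasurableSpace α] (μ : Measure α) (f : α → EReal) : EReal :=
  ((∫⁻ x, (f x).toENNReal ∂μ : ℝ≥0∞) : EReal) - ((∫⁻ x, (-f x).toENNReal ∂μ : ℝ≥0∞) : EReal)

/-- `∬ log (1 / |z - w|) dμ(z) dμ(w)`. -/
def logEnergy (μ : Measure ℂ) : EReal :=
  extIntegral (μ.prod μ) (fun p => logKernel p.1 p.2)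

/-- The weighted energy `I_Q[μ] = ∬ log (1 / |z - w|) dμ(z) dμ(w) + ∫ Q dμ`. -/
def weightedEnergy (Q : ℂ → EReal) (μ : Measure ℂ) : EReal :=
  logEnergy μ + extIntegral μ Q

/-- A compactly supported Borel probability measure on `ℂ`. -/
def IsCompactProb (μ : Measure ℂ) : Prop :=
  IsProbabilityMeasure μ ∧ ∃ K : Set ℂ, IsCompact K ∧ μ Kᶜ = 0

/-- The closed set `Sig` has positive logarithmic capacity: it carries a compactly supported
probability measure of finite logarithmic energy. -/
def HasPositiveCapacity (Sig : Set ℂ) : Prop :=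
  ∃ μ : Measure ℂ, IsCompactProb μ ∧ μ Sigᶜ = 0 ∧ logEnergy μ < ⊤

/-- `σ` minimizes the weighted energy over all compactly supported probability measures. -/
def IsEquilibriumMeasure (Q : ℂ → EReal) (σ : Measure ℂ) : Prop :=
  IsCompactProb σ ∧ ∀ μ : Measure ℂ, IsCompactProb μ → weightedEnergy Q σ ≤ weightedEnergy Q μ

open Classical in
/-- The equilibrium measure `σ[Q]`; for a potential on a compact set of positive capacity the
minimizer exists and is unique. -/
def equilibriumMeasure (Q : ℂ → EReal) : Measure ℂ :=
  if hQ : ∃ σ, IsEquilibriumMeasure Q σ then hQ.choose else 0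

/-- The droplet `S[Q]`, the support of the equilibrium measure. -/
def droplet (Q : ℂ → EReal) : Set ℂ := (equilibriumMeasure Q).support

/-! ### Obstacle function -/

/-- Subharmonic functions on `ℂ`: upper semicontinuous functions with values in `[-∞, ∞)`
satisfying the sub-mean value inequality on every circle. As `s` is upper semicontinuous, its mean
over a circle is the infimum of the means of the continuous real functions that dominate `s` on
this circle; the inequality is stated in this form. -/
def IsSubharmonic (s : ℂ → EReal) : Prop :=
  UpperSemicontinuous s ∧ (∀ z, s z ≠ ⊤) ∧
    ∀ (c : ℂ) (r : ℝ), 0 < r → ∀ g : ℂ → ℝ, ContinuousOn g (Metric.sphere c r) →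
      (∀ w ∈ Metric.sphere c r, s w ≤ ((g w : ℝ) : EReal)) →
      s c ≤ ((Real.circleAverage g c r : ℝ) : EReal)

/-- The competitors for the obstacle problem: `s` is subharmonic, `s ≤ Q` on `ℂ`, and
`s w ≤ 2 log |w| + O(1)` as `w → ∞`. -/
def IsCompetitor (Q : ℂ → EReal) (s : ℂ → EReal) : Prop :=
  IsSubharmonic s ∧ (∀ w, s w ≤ Q w) ∧
    ∃ A : ℝ, ∀ᶠ w in Bornology.cobounded ℂ, s w ≤ ((2 * Real.log ‖w‖ + A : ℝ) : EReal)

/-- The obstacle function, the pointwise supremum of all competitors. -/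
def obstacle (Q : ℂ → EReal) (z : ℂ) : EReal :=
  sSup {x : EReal | ∃ s, IsCompetitor Q s ∧ x = s z}

/-- The coincidence set `S* = {Q = obstacle}`. -/
def coincidenceSet (Q : ℂ → EReal) : Set ℂ := {z | Q z = obstacle Q z}

/-- The effective potential `Q - obstacle`. -/
def effPotential (Q : ℂ → EReal) (z : ℂ) : EReal := Q z - obstacle Q z

/-! ### The Coulomb gas -/

/-- Normalized Lebesgue measure `dA = dx dy / π`. -/
def area : Measure ℂ := NNReal.pi⁻¹ • (volume : Measure ℂ)

/-- The product measure `dA_n` on `ℂⁿ`. -/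
def areaPi (n : ℕ) : Measure (Fin n → ℂ) := Measure.pi (fun _ => area)

/-- The Hamiltonian `∑_{i ≠ j} log (1 / |z_i - z_j|) + n ∑_i Q(z_i)`; the first sum is over ordered
pairs. -/
def hamiltonian (Q : ℂ → EReal) (n : ℕ) (z : Fin n → ℂ) : EReal :=
  (∑ i : Fin n, ∑ j ∈ Finset.univ.filter (fun j : Fin n => j ≠ i), logKernel (z i) (z j))
    + ((n : ℝ) : EReal) * ∑ i : Fin n, Q (z i)

/-- The Boltzmann factor `exp (-β H_n)`, which is `0` where `H_n = +∞`. -/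
def boltzmann (Q : ℂ → EReal) (β : ℝ) (n : ℕ) (z : Fin n → ℂ) : ℝ≥0∞ :=
  EReal.exp (-((β : EReal) * hamiltonian Q n z))

/-- The normalizing constant `Z_n^β`. -/
def partitionFunction (Q : ℂ → EReal) (β : ℝ) (n : ℕ) : ℝ≥0∞ :=
  ∫⁻ z, boltzmann Q β n z ∂(areaPi n)

/-- The Boltzmann-Gibbs measure on `ℂⁿ`. -/
def gibbs (Q : ℂ → EReal) (β : ℝ) (n : ℕ) : Measure (Fin n → ℂ) :=
  (partitionFunction Q β n)⁻¹ • (areaPi n).withDensity (boltzmann Q β n)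

/-- The number of particles `z_i` in the disc with center `p` and radius `ε`. -/
def particleCount {n : ℕ} (p : ℂ) (ε : ℝ) (z : Fin n → ℂ) : ℝ≥0∞ :=
  ∑ i : Fin n, (Metric.closedBall p ε).indicator (fun _ => (1 : ℝ≥0∞)) (z i)

/-- The 1-point function `R_n^β(p)`, the limit of `E[N(p, ε)] / ε²` as `ε → 0+`. The upper limit is
taken, which is the limit wherever the latter exists and is defined at every point. -/
def onePoint (Q : ℂ → EReal) (β : ℝ) (n : ℕ) (p : ℂ) : ℝ≥0∞ :=
  limsup (fun ε : ℝ => (∫⁻ z, particleCount p ε z ∂(gibbs Q β n)) / ENNReal.ofReal (ε ^ 2))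
    (𝓝[>] (0 : ℝ))

end

end HeleShaw

namespace HeleShaw

/-! Write `n = m + 1`. Everything rests on Jensen's inequality, applied to the weight of one
particle when the others are fixed. If a particle at `w` is moved to a uniform point of a circle of
radius `ρ` about `w` inside `Sig`, the mean of `Q` grows by exactly `Δ ρ²`, since `h` is harmonic,
and each log-distance to another particle averages to `log (max ρ ‖w - x j‖)`. So the move costs a
factor `exp (β n Δ ρ²)` and rewards particles that were too close (`condWeight_isotropic_average`).

Local law: on the scale `n Δ (4 r)² ≤ 1`, moving a particle to radius `4 r` costs at most `e^β`,
while every other particle in its disc of radius `r` yields a gain of at least `2^(2β)`. Having many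
more than `1 / β` neighbours is therefore unfavourable, and the expected count in a disc is at most
`s + 1` plus half a bound for the counts in the discs at distance `4 r` (`expectedCount_step`).
Iteration over a macroscopic distance, starting from the trivial bound `n`, leaves a constant
(`expectedCount_le_const`).

Transfer to an arbitrary `p` in `Sig`: the truncated log-interaction `u` with the other particles,
divided by `n`, is subharmonic with growth at most `2 log |w|`. Up to a constant it competes in the
obstacle problem, so `u p - n o`, with `o` the obstacle at `p`, is at most the maximum of `u - n Q`
over the coincidence set. A minimax argument replaces this maximum by a weighted mean over finitely
many coincidence points, with weights independent of the configuration
(`exists_weights_coincidenceSet`): a discrete harmonic measure. Jensen for these weights, then on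
circles about their points, bounds the density at `p` by `exp (-n β Q_eff)` times expected counts in
microscopic discs about coincidence points, where the local law applies. -/

/-! ### Circle averages and Jensen's inequality. -/

theorem circleAverage_log_norm_sub (a c : ℂ) {r : ℝ} (hr : 0 < r) :
    Real.circleAverage (fun z => Real.log ‖z - a‖) c r = Real.log (max r ‖c - a‖) := by
  rw [circleAverage_log_norm_sub_const_eq_log_radius_add_posLog hr.ne']
  rcases le_total r ‖c - a‖ with h | h
  · have hpos : 0 < ‖c - a‖ := hr.trans_le h
    rw [max_eq_right h, Real.posLog_eq_log, Real.log_mul (by positivity) hpos.ne', Real.log_inv]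
    · ring
    · rw [abs_of_nonneg (by positivity), inv_mul_eq_div, one_le_div hr]
      exact h
  · rw [max_eq_left h, (Real.posLog_eq_zero_iff _).2, add_zero]
    rw [abs_of_nonneg (by positivity), inv_mul_eq_div, div_le_one hr]
    exact h

theorem circleAverage_norm_sq (c : ℂ) (r : ℝ) :
    Real.circleAverage (fun z => ‖z‖ ^ 2) c r = ‖c‖ ^ 2 + r ^ 2 := by
  have hL : InnerProductSpace.HarmonicOnNhd
      (fun z : ℂ => (2 * (starRingEnd ℂ c * z)).re) (Metric.closedBall c |r|) := by
    intro z _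
    exact AnalyticAt.harmonicAt_re (f := fun z => 2 * (starRingEnd ℂ c * z)) (by fun_prop)
  -- On the circle `‖z‖²` coincides with a harmonic function, to which the mean value property
  -- applies.
  have h1 : Set.EqOn (fun z : ℂ => ‖z‖ ^ 2)
      (fun z => (r ^ 2 - ‖c‖ ^ 2) + (2 * (starRingEnd ℂ c * z)).re) (Metric.sphere c |r|) := by
    intro z hz
    have hz' : ‖z - c‖ ^ 2 = r ^ 2 := by
      rw [mem_sphere_iff_norm.1 hz, sq_abs]
    simp only [← Complex.normSq_eq_norm_sq, Complex.normSq_apply] at hz' ⊢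
    simp at hz' ⊢
    nlinarith
  rw [Real.circleAverage_congr_sphere h1, Real.circleAverage_fun_add, Real.circleAverage_const,
    hL.circleAverage_eq]
  · have : (2 * (starRingEnd ℂ c * c)).re = 2 * ‖c‖ ^ 2 := by
      rw [mul_comm (starRingEnd ℂ c), Complex.mul_conj, Complex.normSq_eq_norm_sq]
      norm_cast
    rw [this]; ring
  · exact circleIntegrable_const _ _ _
  · exact ContinuousOn.circleIntegrable' (Continuous.continuousOn (by fun_prop))

theorem continuousOn_of_harmonicOnNhd {h : ℂ → ℝ} {s : Set ℂ}
    (hh : InnerProductSpace.HarmonicOnNhd h s) : ContinuousOn h s :=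
  fun z hz => (hh z hz).1.continuousAt.continuousWithinAt

theorem circleAverage_quadratic_add_harmonic {h : ℂ → ℝ} {c : ℂ} {r : ℝ} (Δ : ℝ)
    (hh : InnerProductSpace.HarmonicOnNhd h (Metric.closedBall c |r|)) :
    Real.circleAverage (fun z => Δ * ‖z‖ ^ 2 + h z) c r
      = Δ * ‖c‖ ^ 2 + h c + Δ * r ^ 2 := by
  have hint : CircleIntegrable h c r := ContinuousOn.circleIntegrable'
    ((continuousOn_of_harmonicOnNhd hh).mono Metric.sphere_subset_closedBall)
  rw [Real.circleAverage_fun_add (ContinuousOn.circleIntegrable' (Continuous.continuousOn (by fun_prop))) hint,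
    hh.circleAverage_eq]
  have := Real.circleAverage_fun_smul (a := Δ) (f := fun z : ℂ => ‖z‖ ^ 2) (c := c) (R := r)
  simp only [smul_eq_mul] at this
  rw [this, circleAverage_norm_sq]
  ring

/-- The uniform probability measure on the angles `(0, 2π]`. -/
noncomputable def angleMeasure : Measure ℝ :=
  ENNReal.ofReal (2 * Real.pi)⁻¹ • volume.restrict (Set.Ioc 0 (2 * Real.pi))

instance : IsProbabilityMeasure angleMeasure := by
  constructor
  rw [angleMeasure, Measure.smul_apply, Measure.restrict_apply MeasurableSet.univ, Set.univ_inter,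
    Real.volume_Ioc, smul_eq_mul, ← ENNReal.ofReal_mul (by positivity), sub_zero,
    inv_mul_cancel₀ (by positivity), ENNReal.ofReal_one]

theorem integral_angleMeasure (f : ℂ → ℝ) (c : ℂ) (r : ℝ) :
    ∫ θ, f (circleMap c r θ) ∂angleMeasure = Real.circleAverage f c r := by
  rw [angleMeasure, integral_smul_measure, Real.circleAverage_def,
    intervalIntegral.integral_of_le (by positivity), ENNReal.toReal_ofReal (by positivity)]

theorem integrable_angleMeasure {f : ℂ → ℝ} {c : ℂ} {r : ℝ} (hf : CircleIntegrable f c r) :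
    Integrable (fun θ => f (circleMap c r θ)) angleMeasure := by
  refine Integrable.smul_measure ?_ ENNReal.ofReal_ne_top
  exact (intervalIntegrable_iff_integrableOn_Ioc_of_le (by positivity)).1 hf

/-- Needed because `Real.log 0 = 0`: at a pole, `exp (log ‖z - a‖)` is `1` instead of `0`, so
pointwise identities with logarithms hold only off the poles. -/
theorem ae_circleMap_ne (a c : ℂ) {r : ℝ} (hr : r ≠ 0) :
    ∀ᵐ θ ∂angleMeasure, circleMap c r θ ≠ a := by
  refine Measure.ae_smul_measure (ae_restrict_of_ae ?_) _
  have : (circleMap c r ⁻¹' {a}).Countable :=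
    Set.Countable.preimage_circleMap (Set.countable_singleton _) c hr
  rw [ae_iff]
  refine measure_mono_null (fun θ hθ => ?_) (this.measure_zero volume)
  simpa using hθ

/-- Jensen's inequality for the exponential function, in terms of the lower integral. -/
theorem ofReal_exp_integral_le_lintegral {α : Type*} [MeasurableSpace α] {μ : Measure α}
    [IsProbabilityMeasure μ] {g : α → ℝ} (hg : Integrable g μ) :
    ENNReal.ofReal (Real.exp (∫ x, g x ∂μ)) ≤ ∫⁻ x, ENNReal.ofReal (Real.exp (g x)) ∂μ := by
  by_cases he : Integrable (fun x => Real.exp (g x)) μ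
  · rw [← ofReal_integral_eq_lintegral_ofReal he (ae_of_all _ fun _ => (Real.exp_pos _).le)]
    exact ENNReal.ofReal_le_ofReal (convexOn_exp.map_integral_le Real.continuous_exp.continuousOn
      isClosed_univ (ae_of_all _ fun _ => Set.mem_univ _) hg he)
  · have hm : AEStronglyMeasurable (fun x => Real.exp (g x)) μ :=
      Real.continuous_exp.comp_aestronglyMeasurable hg.1
    have : ¬ ∫⁻ x, ENNReal.ofReal (Real.exp (g x)) ∂μ ≠ ⊤ := fun h =>
      he ((lintegral_ofReal_ne_top_iff_integrable hm
        (ae_of_all _ fun _ => (Real.exp_pos _).le)).1 h)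
    rw [not_not.1 this]
    exact le_top

/-! ### Factorization of the Boltzmann weight. -/

/-- The value `⊥` must be excluded: `⊤ + ⊥ = ⊥` would give `⊤` on the left, against `0 * ⊤ = 0` on
the right. -/
theorem exp_neg_mul_add {β : ℝ} (hβ : 0 < β) {a b : EReal} (ha : a ≠ ⊥) (hb : b ≠ ⊥) :
    EReal.exp (-((β : EReal) * (a + b)))
      = EReal.exp (-((β : EReal) * a)) * EReal.exp (-((β : EReal) * b)) := by
  induction a with
  | bot => exact absurd rfl ha
  | top => rw [EReal.top_add_of_ne_bot hb, EReal.coe_mul_top_of_pos hβ]; simp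
  | coe a =>
    induction b with
    | bot => exact absurd rfl hb
    | top => rw [EReal.add_top_of_ne_bot ha, EReal.coe_mul_top_of_pos hβ]; simp
    | coe b =>
      rw [← EReal.exp_add]
      norm_cast
      congr 2
      ring

theorem sum_ne_bot {ι : Type*} (s : Finset ι) {t : ι → EReal} (ht : ∀ i ∈ s, t i ≠ ⊥) :
    ∑ i ∈ s, t i ≠ ⊥ := by
  classical
  induction s using Finset.induction_on with
  | empty => simp
  | insert a s ha ih =>
    rw [Finset.sum_insert ha]
    simp only [ne_eq, EReal.add_eq_bot_iff, not_or]
    exact ⟨ht a (Finset.mem_insert_self a s),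
      ih fun i hi => ht i (Finset.mem_insert_of_mem hi)⟩

theorem exp_neg_mul_sum {ι : Type*} (s : Finset ι) {β : ℝ} (hβ : 0 < β) {t : ι → EReal}
    (ht : ∀ i ∈ s, t i ≠ ⊥) :
    EReal.exp (-((β : EReal) * ∑ i ∈ s, t i)) = ∏ i ∈ s, EReal.exp (-((β : EReal) * t i)) := by
  classical
  induction s using Finset.induction_on with
  | empty => simp
  | insert a s ha ih =>
    have hs : ∀ i ∈ s, t i ≠ ⊥ := fun i hi => ht i (Finset.mem_insert_of_mem hi)
    rw [Finset.sum_insert ha, Finset.prod_insert ha,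
      exp_neg_mul_add hβ (ht a (Finset.mem_insert_self a s)) (sum_ne_bot s hs), ih hs]

theorem logKernel_ne_bot (z w : ℂ) : logKernel z w ≠ ⊥ := by
  rw [logKernel, ne_eq, EReal.neg_eq_bot_iff, ENNReal.log_eq_top_iff]
  exact edist_ne_top z w

theorem exp_neg_mul_logKernel (β : ℝ) (z w : ℂ) :
    EReal.exp (-((β : EReal) * logKernel z w)) = edist z w ^ β := by
  rw [logKernel, mul_neg, neg_neg, ENNReal.rpow_eq_exp_mul_log]

theorem potential_ne_bot (Sig : Set ℂ) (Δ : ℝ) (h : ℂ → ℝ) (z : ℂ) :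
    potential Sig Δ h z ≠ ⊥ := by
  rw [potential]
  split_ifs
  · exact EReal.coe_ne_bot _
  · exact top_ne_bot

/-- The one-body factor `exp (-b Q(z))`. -/
noncomputable def siteWeight (Q : ℂ → EReal) (b : ℝ) (z : ℂ) : ℝ≥0∞ :=
  EReal.exp (-((b : EReal) * Q z))

/-- The part of the Boltzmann factor involving the particle at `q`, the others being at `x`. -/
noncomputable def condWeight (Q : ℂ → EReal) (β : ℝ) {m : ℕ} (q : ℂ) (x : Fin m → ℂ) : ℝ≥0∞ :=
  (∏ j, edist q (x j) ^ (2 * β)) * siteWeight Q (β * (m + 1)) q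

/-- The part of the Boltzmann factor of `m + 1` particles that involves only the `m` last ones. -/
noncomputable def restWeight (Q : ℂ → EReal) (β : ℝ) {m : ℕ} (x : Fin m → ℂ) : ℝ≥0∞ :=
  (∏ i, ∏ j, if j ≠ i then edist (x i) (x j) ^ β else 1) * ∏ i, siteWeight Q (β * (m + 1)) (x i)

theorem boltzmann_eq_prod {Q : ℂ → EReal} (hQ : ∀ z, Q z ≠ ⊥) {β : ℝ} (hβ : 0 < β) (m : ℕ)
    (z : Fin (m + 1) → ℂ) :
    boltzmann Q β (m + 1) z
      = (∏ i, ∏ j, if j ≠ i then edist (z i) (z j) ^ β else 1)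
          * ∏ i, siteWeight Q (β * (m + 1)) (z i) := by
  have hn : (0 : ℝ) < ((m + 1 : ℕ) : ℝ) := by positivity
  have hsum : ∑ i, Q (z i) ≠ ⊥ := sum_ne_bot _ fun i _ => hQ _
  have hmul : ((((m + 1 : ℕ) : ℝ)) : EReal) * ∑ i, Q (z i) ≠ ⊥ := by
    intro h
    rw [EReal.mul_eq_bot] at h
    rcases h with h | h | h | h
    · exact EReal.coe_ne_bot _ h.1
    · exact hsum h.2
    · exact EReal.coe_ne_top _ h.1
    · exact not_lt_of_gt hn (EReal.coe_neg'.1 h.1)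
  rw [boltzmann, hamiltonian, exp_neg_mul_add hβ _ hmul]
  · congr 1
    · rw [exp_neg_mul_sum _ hβ fun i _ => sum_ne_bot _ fun j _ => logKernel_ne_bot _ _]
      refine Finset.prod_congr rfl fun i _ => ?_
      rw [exp_neg_mul_sum _ hβ fun j _ => logKernel_ne_bot _ _, Finset.prod_filter]
      simp only [exp_neg_mul_logKernel]
    · rw [← mul_assoc, ← EReal.coe_mul, exp_neg_mul_sum _ (mul_pos hβ hn) fun i _ => hQ _]
      simp only [siteWeight, Nat.cast_add, Nat.cast_one]
  · exact sum_ne_bot _ fun i _ => sum_ne_bot _ fun j _ => logKernel_ne_bot _ _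

theorem boltzmann_insertNth {Q : ℂ → EReal} (hQ : ∀ z, Q z ≠ ⊥) {β : ℝ} (hβ : 0 < β) {m : ℕ}
    (i : Fin (m + 1)) (q : ℂ) (x : Fin m → ℂ) :
    boltzmann Q β (m + 1) (i.insertNth q x) = condWeight Q β q x * restWeight Q β x := by
  rw [boltzmann_eq_prod hQ hβ, condWeight, restWeight, Fin.prod_univ_succAbove _ i,
    Fin.prod_univ_succAbove _ i, Fin.prod_univ_succAbove _ i]
  -- The particle at `q` meets each other particle in two ordered pairs, hence the exponent `2 * β`.
  have h2 : ∀ j, edist q (x j) ^ (2 * β) = edist q (x j) ^ β * edist q (x j) ^ β := fun j => by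
    rw [two_mul, ENNReal.rpow_add_of_nonneg _ _ hβ.le hβ.le]
  simp only [Fin.prod_univ_succAbove _ i, Fin.insertNth_apply_same, Fin.insertNth_apply_succAbove,
    ne_eq, not_true_eq_false, if_false, Fin.succAbove_ne, not_false_eq_true, if_true,
    Fin.ne_succAbove, Fin.succAbove_right_inj, Finset.prod_mul_distrib, h2, one_mul]
  simp only [edist_comm _ q]
  ring

theorem siteWeight_potential {Sig : Set ℂ} {Δ : ℝ} {h : ℂ → ℝ} {b : ℝ} (hb : 0 < b) (z : ℂ) :
    siteWeight (potential Sig Δ h) b z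
      = Sig.indicator (fun z => ENNReal.ofReal (Real.exp (-(b * (Δ * ‖z‖ ^ 2 + h z))))) z := by
  classical
  rw [siteWeight, potential]
  by_cases hz : z ∈ Sig
  · rw [if_pos hz, Set.indicator_of_mem hz, ← EReal.coe_mul, ← EReal.coe_neg, EReal.exp_coe]
  · rw [if_neg hz, Set.indicator_of_notMem hz, EReal.coe_mul_top_of_pos hb]
    simp

theorem measurable_siteWeight {Sig : Set ℂ} (hS : IsClosed Sig) {Δ : ℝ} {h : ℂ → ℝ}
    (hh : ContinuousOn h Sig) {b : ℝ} (hb : 0 < b) :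
    Measurable (siteWeight (potential Sig Δ h) b) := by
  classical
  have : siteWeight (potential Sig Δ h) b
      = Sig.indicator fun z => ENNReal.ofReal (Real.exp (-(b * (Δ * ‖z‖ ^ 2 + h z)))) :=
    funext fun z => siteWeight_potential hb z
  rw [this, ← Set.piecewise_eq_indicator]
  refine ContinuousOn.measurable_piecewise ?_ continuousOn_const hS.measurableSet
  exact ENNReal.continuous_ofReal.comp_continuousOn (by fun_prop)

theorem measurable_condWeight {Sig : Set ℂ} (hS : IsClosed Sig) {Δ : ℝ} {h : ℂ → ℝ}
    (hh : ContinuousOn h Sig) {β : ℝ} (hβ : 0 < β) {m : ℕ} {α : Type*} [MeasurableSpace α]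
    {f : α → ℂ} {g : α → Fin m → ℂ} (hf : Measurable f) (hg : Measurable g) :
    Measurable fun a => condWeight (potential Sig Δ h) β (f a) (g a) := by
  unfold condWeight
  refine Measurable.mul ?_ ((measurable_siteWeight hS hh (mul_pos hβ (by positivity))).comp hf)
  refine Finset.measurable_prod _ fun j _ => Measurable.pow_const ?_ _
  exact hf.edist ((measurable_pi_apply j).comp hg)

theorem measurable_restWeight {Sig : Set ℂ} (hS : IsClosed Sig) {Δ : ℝ} {h : ℂ → ℝ}
    (hh : ContinuousOn h Sig) {β : ℝ} (hβ : 0 < β) {m : ℕ} {α : Type*} [MeasurableSpace α]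
    {g : α → Fin m → ℂ} (hg : Measurable g) :
    Measurable fun a => restWeight (potential Sig Δ h) β (g a) := by
  have hg' : ∀ i, Measurable fun a => g a i := fun i => (measurable_pi_apply i).comp hg
  unfold restWeight
  refine Measurable.mul ?_ (Finset.measurable_prod _ fun i _ =>
    (measurable_siteWeight hS hh (mul_pos hβ (by positivity))).comp (hg' i))
  refine Finset.measurable_prod _ fun i _ => Finset.measurable_prod _ fun j _ => ?_
  split_ifs
  · exact Measurable.pow_const ((hg' i).edist (hg' j)) _
  · exact measurable_const

/-! ### Isotropic averaging of one particle. -/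

/-- Jensen's inequality for the conditional weight: moving the particle at `w` to a random point
of a circle about `w`. -/
theorem condWeight_isotropic_average {Sig : Set ℂ} {Δ : ℝ} {h : ℂ → ℝ}
    (hh : InnerProductSpace.HarmonicOnNhd h Sig) {β : ℝ} (hβ : 0 < β) {m : ℕ}
    (x : Fin m → ℂ) {w : ℂ} {ρ : ℝ} (hρ : 0 < ρ) (hw : Metric.closedBall w ρ ⊆ Sig) :
    ENNReal.ofReal (Real.exp ((∑ j, 2 * β * Real.log (max ρ ‖w - x j‖))
        - β * (m + 1) * (Δ * ‖w‖ ^ 2 + h w + Δ * ρ ^ 2)))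
      ≤ ∫⁻ θ, condWeight (potential Sig Δ h) β (circleMap w ρ θ) x ∂angleMeasure := by
  set b : ℝ := β * (m + 1) with hb
  have hbpos : 0 < b := by positivity
  set g : ℂ → ℝ := fun z =>
    (∑ j, 2 * β * Real.log ‖z - x j‖) - b * (Δ * ‖z‖ ^ 2 + h z) with hg
  have hsub : Metric.closedBall w |ρ| ⊆ Sig := by rwa [abs_of_pos hρ]
  have hi1 : ∀ j, CircleIntegrable (fun z => 2 * β * Real.log ‖z - x j‖) w ρ := fun j =>
    (circleIntegrable_log_norm_sub_const ρ).const_mul _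
  have hi1' : CircleIntegrable (fun z => ∑ j, 2 * β * Real.log ‖z - x j‖) w ρ := by
    have := CircleIntegrable.sum Finset.univ (fun j _ => hi1 j)
    convert this using 1
    ext z; simp
  have hi2 : CircleIntegrable (fun z => Δ * ‖z‖ ^ 2 + h z) w ρ :=
    ContinuousOn.circleIntegrable' (by
      have := (continuousOn_of_harmonicOnNhd hh).mono
        (Metric.sphere_subset_closedBall.trans hsub)
      fun_prop)
  have hi2' : CircleIntegrable (fun z => b * (Δ * ‖z‖ ^ 2 + h z)) w ρ := hi2.const_mul _
  have hgi : CircleIntegrable g w ρ := hi1'.sub hi2'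
  have havg : Real.circleAverage g w ρ = (∑ j, 2 * β * Real.log (max ρ ‖w - x j‖))
        - b * (Δ * ‖w‖ ^ 2 + h w + Δ * ρ ^ 2) := by
    rw [hg, Real.circleAverage_fun_sub hi1' hi2', Real.circleAverage_fun_sum fun j _ => hi1 j]
    have e1 : ∀ (c : ℝ) (f : ℂ → ℝ), Real.circleAverage (fun z => c * f z) w ρ
        = c * Real.circleAverage f w ρ := fun c f =>
      Real.circleAverage_fun_smul (a := c) (f := f)
    simp only [e1, circleAverage_log_norm_sub _ _ hρ]
    rw [circleAverage_quadratic_add_harmonic Δ fun z hz => hh z (hsub hz)]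
  rw [← havg, ← integral_angleMeasure]
  refine (ofReal_exp_integral_le_lintegral (integrable_angleMeasure hgi)).trans
    (lintegral_mono_ae ?_)
  filter_upwards [ae_all_iff.2 fun j => ae_circleMap_ne (x j) w hρ.ne'] with θ hθ
  have hmem : circleMap w ρ θ ∈ Sig := hsub (by
    rw [abs_of_pos hρ]; exact circleMap_mem_closedBall w hρ.le θ)
  rw [condWeight, siteWeight_potential hbpos, Set.indicator_of_mem hmem, hg]
  simp only
  rw [sub_eq_add_neg, Real.exp_add, ENNReal.ofReal_mul (Real.exp_pos _).le, Real.exp_sum,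
    ENNReal.ofReal_prod_of_nonneg fun _ _ => (Real.exp_pos _).le]
  refine le_of_eq ?_
  congr 1
  refine Finset.prod_congr rfl fun j _ => ?_
  have hpos : 0 < ‖circleMap w ρ θ - x j‖ := norm_pos_iff.2 (sub_ne_zero.2 (hθ j))
  rw [edist_eq_enorm_sub, ← ofReal_norm, ENNReal.ofReal_rpow_of_pos hpos,
    Real.rpow_def_of_pos hpos, mul_comm]

/-! ### Gibbs expectations by Fubini, and counting of particles. -/

instance : SigmaFinite area := by unfold area; infer_instance

instance : area.IsAddRightInvariant := by unfold area; infer_instance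

instance (m : ℕ) : SigmaFinite (areaPi m) := by unfold areaPi; infer_instance

theorem lintegral_areaPi_succ (m : ℕ) {F : (Fin (m + 1) → ℂ) → ℝ≥0∞} (hF : Measurable F)
    (i : Fin (m + 1)) :
    ∫⁻ z, F z ∂(areaPi (m + 1)) = ∫⁻ q, ∫⁻ x, F (i.insertNth q x) ∂(areaPi m) ∂area := by
  have hmp := (measurePreserving_piFinSuccAbove (fun _ : Fin (m + 1) => area) i).symm
  have := hmp.lintegral_comp hF
  rw [areaPi, ← this, lintegral_prod]
  · rfl
  · exact (hF.comp (MeasurableEquiv.measurable _)).aemeasurable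

/-- The unnormalized one-particle density. -/
noncomputable def marginalWeight (Q : ℂ → EReal) (β : ℝ) (m : ℕ) (q : ℂ) : ℝ≥0∞ :=
  ∫⁻ x : Fin m → ℂ, condWeight Q β q x * restWeight Q β x ∂(areaPi m)

theorem measurable_cond_mul_rest {Sig : Set ℂ} (hS : IsClosed Sig) {Δ : ℝ} {h : ℂ → ℝ}
    (hh : ContinuousOn h Sig) {β : ℝ} (hβ : 0 < β) {m : ℕ} {α : Type*} [MeasurableSpace α]
    {f : α → ℂ} {g : α → Fin m → ℂ} (hf : Measurable f) (hg : Measurable g) :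
    Measurable fun a => condWeight (potential Sig Δ h) β (f a) (g a)
      * restWeight (potential Sig Δ h) β (g a) :=
  (measurable_condWeight hS hh hβ hf hg).mul (measurable_restWeight hS hh hβ hg)

theorem measurable_marginalWeight {Sig : Set ℂ} (hS : IsClosed Sig) {Δ : ℝ} {h : ℂ → ℝ}
    (hh : ContinuousOn h Sig) {β : ℝ} (hβ : 0 < β) (m : ℕ) :
    Measurable (marginalWeight (potential Sig Δ h) β m) :=
  (measurable_cond_mul_rest (m := m) hS hh hβ measurable_fst
    measurable_snd).lintegral_prod_right'

theorem measurable_boltzmann {Sig : Set ℂ} (hS : IsClosed Sig) {Δ : ℝ} {h : ℂ → ℝ}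
    (hh : ContinuousOn h Sig) {β : ℝ} (hβ : 0 < β) (m : ℕ) :
    Measurable (boltzmann (potential Sig Δ h) β (m + 1)) := by
  have : boltzmann (potential Sig Δ h) β (m + 1) = _ :=
    funext fun z => boltzmann_eq_prod (potential_ne_bot Sig Δ h) hβ m z
  rw [this]
  refine Measurable.mul ?_ (Finset.measurable_prod _ fun i _ =>
    (measurable_siteWeight hS hh (mul_pos hβ (by positivity))).comp (measurable_pi_apply i))
  refine Finset.measurable_prod _ fun i _ => Finset.measurable_prod _ fun j _ => ?_
  split_ifs
  · exact Measurable.pow_const ((measurable_pi_apply i).edist (measurable_pi_apply j)) _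
  · exact measurable_const

theorem lintegral_gibbs {Sig : Set ℂ} (hS : IsClosed Sig) {Δ : ℝ} {h : ℂ → ℝ}
    (hh : ContinuousOn h Sig) {β : ℝ} (hβ : 0 < β) (m : ℕ) {f : (Fin (m + 1) → ℂ) → ℝ≥0∞}
    (hf : Measurable f) :
    ∫⁻ z, f z ∂(gibbs (potential Sig Δ h) β (m + 1))
      = (partitionFunction (potential Sig Δ h) β (m + 1))⁻¹
        * ∫⁻ z, f z * boltzmann (potential Sig Δ h) β (m + 1) z ∂(areaPi (m + 1)) := by
  rw [gibbs, lintegral_smul_measure, smul_eq_mul,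
    lintegral_withDensity_eq_lintegral_mul _ (measurable_boltzmann hS hh hβ m) hf]
  simp only [Pi.mul_apply, mul_comm]

/-- The Gibbs expectation of a sum over the particles of a function of one particle and the
others. -/
theorem lintegral_gibbs_sum {Sig : Set ℂ} (hS : IsClosed Sig) {Δ : ℝ} {h : ℂ → ℝ}
    (hh : ContinuousOn h Sig) {β : ℝ} (hβ : 0 < β) (m : ℕ) {φ : ℂ → (Fin m → ℂ) → ℝ≥0∞}
    (hφ : Measurable fun p : ℂ × (Fin m → ℂ) => φ p.1 p.2) :
    ∫⁻ z, ∑ i, φ (z i) (i.removeNth z) ∂(gibbs (potential Sig Δ h) β (m + 1))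
      = (partitionFunction (potential Sig Δ h) β (m + 1))⁻¹ * ((m + 1)
        * ∫⁻ q, ∫⁻ x, φ q x * (condWeight (potential Sig Δ h) β q x
          * restWeight (potential Sig Δ h) β x) ∂(areaPi m) ∂area) := by
  have hm : ∀ i : Fin (m + 1), Measurable fun z : Fin (m + 1) → ℂ => φ (z i) (i.removeNth z) := by
    intro i
    have h2 : Measurable fun z : Fin (m + 1) → ℂ => (z i, i.removeNth z) :=
      (measurable_pi_apply i).prodMk (measurable_pi_iff.2 fun j => measurable_pi_apply _)
    exact hφ.comp h2
  have hB := measurable_boltzmann (Δ := Δ) hS hh hβ m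
  rw [lintegral_gibbs hS hh hβ m (Finset.measurable_sum _ fun i _ => hm i)]
  congr 1
  simp only [Finset.sum_mul]
  have hm2 : ∀ i ∈ (Finset.univ : Finset (Fin (m + 1))), Measurable fun z : Fin (m + 1) → ℂ =>
      φ (z i) (i.removeNth z) * boltzmann (potential Sig Δ h) β (m + 1) z :=
    fun i _ => (hm i).mul hB
  rw [lintegral_finsetSum _ hm2]
  have : ∀ i : Fin (m + 1), ∫⁻ z, φ (z i) (i.removeNth z)
      * boltzmann (potential Sig Δ h) β (m + 1) z ∂(areaPi (m + 1))
      = ∫⁻ q, ∫⁻ x, φ q x * (condWeight (potential Sig Δ h) β q x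
          * restWeight (potential Sig Δ h) β x) ∂(areaPi m) ∂area := by
    intro i
    rw [lintegral_areaPi_succ m (hm2 i (Finset.mem_univ i)) i]
    simp only [Fin.insertNth_apply_same, Fin.removeNth_insertNth,
      boltzmann_insertNth (potential_ne_bot Sig Δ h) hβ]
  simp [this]

/-- The expected number of particles in a closed disc. -/
noncomputable def expectedCount (Q : ℂ → EReal) (β : ℝ) (n : ℕ) (p : ℂ) (r : ℝ) : ℝ≥0∞ :=
  ∫⁻ z, particleCount p r z ∂(gibbs Q β n)

theorem expectedCount_eq {Sig : Set ℂ} (hS : IsClosed Sig) {Δ : ℝ} {h : ℂ → ℝ}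
    (hh : ContinuousOn h Sig) {β : ℝ} (hβ : 0 < β) (m : ℕ) (p : ℂ) (r : ℝ) :
    expectedCount (potential Sig Δ h) β (m + 1) p r
      = (partitionFunction (potential Sig Δ h) β (m + 1))⁻¹ * ((m + 1)
        * ∫⁻ q in Metric.closedBall p r, marginalWeight (potential Sig Δ h) β m q ∂area) := by
  have hD : MeasurableSet (Metric.closedBall p r) := Metric.isClosed_closedBall.measurableSet
  have := lintegral_gibbs_sum (Δ := Δ) hS hh hβ m
    (φ := fun q _ => (Metric.closedBall p r).indicator (fun _ => (1 : ℝ≥0∞)) q)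
    ((measurable_const.indicator hD).comp measurable_fst)
  rw [expectedCount]
  unfold particleCount
  rw [this, ← lintegral_indicator hD]
  congr 3
  ext q
  by_cases hq : q ∈ Metric.closedBall p r
  · simp [Set.indicator_of_mem hq, marginalWeight]
  · simp [Set.indicator_of_notMem hq]

/-- An inequality suffices throughout and needs neither `Z ≠ 0` nor `Z ≠ ⊤`. -/
theorem gibbs_univ_le_one {Sig : Set ℂ} (hS : IsClosed Sig) {Δ : ℝ} {h : ℂ → ℝ}
    (hh : ContinuousOn h Sig) {β : ℝ} (hβ : 0 < β) (m : ℕ) :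
    ∫⁻ _, 1 ∂(gibbs (potential Sig Δ h) β (m + 1)) ≤ 1 := by
  rw [lintegral_gibbs hS hh hβ m measurable_const]
  simp only [one_mul]
  exact ENNReal.inv_mul_le_one _

/-- The number of points of a configuration in a closed disc. -/
noncomputable def pointCount {k : ℕ} (p : ℂ) (r : ℝ) (z : Fin k → ℂ) : ℕ :=
  open Classical in (Finset.univ.filter fun i => z i ∈ Metric.closedBall p r).card

theorem particleCount_eq_pointCount {k : ℕ} (p : ℂ) (r : ℝ) (z : Fin k → ℂ) :
    particleCount p r z = pointCount p r z := by
  classical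
  rw [particleCount, pointCount, Finset.card_filter]
  push_cast
  refine Finset.sum_congr rfl fun i _ => ?_
  by_cases hz : z i ∈ Metric.closedBall p r
  · rw [Set.indicator_of_mem hz, if_pos hz]
  · rw [Set.indicator_of_notMem hz, if_neg hz]

theorem pointCount_removeNth {m : ℕ} {p : ℂ} {r : ℝ} {z : Fin (m + 1) → ℂ} {i : Fin (m + 1)}
    (hi : z i ∈ Metric.closedBall p r) :
    pointCount p r z = pointCount p r (i.removeNth z) + 1 := by
  classical
  rw [pointCount, pointCount, Finset.card_filter, Finset.card_filter,
    Fin.sum_univ_succAbove _ i, if_pos hi, add_comm]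
  rfl

theorem measurable_pointCount {k : ℕ} (p : ℂ) (r : ℝ) :
    Measurable fun z : Fin k → ℂ => pointCount p r z := by
  classical
  unfold pointCount
  simp only [Finset.card_filter]
  refine Finset.measurable_sum _ fun i _ => Measurable.ite ?_ measurable_const measurable_const
  exact measurable_pi_apply i Metric.isClosed_closedBall.measurableSet

theorem expectedCount_le_card {Sig : Set ℂ} (hS : IsClosed Sig) {Δ : ℝ} {h : ℂ → ℝ}
    (hh : ContinuousOn h Sig) {β : ℝ} (hβ : 0 < β) (m : ℕ) (p : ℂ) (r : ℝ) :
    expectedCount (potential Sig Δ h) β (m + 1) p r ≤ (m + 1 : ℕ) := by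
  calc expectedCount (potential Sig Δ h) β (m + 1) p r
      ≤ ∫⁻ _, ((m + 1 : ℕ) : ℝ≥0∞) * 1 ∂(gibbs (potential Sig Δ h) β (m + 1)) := by
        refine lintegral_mono fun z => ?_
        rw [particleCount_eq_pointCount, mul_one]
        classical
        exact Nat.cast_le.2 ((Finset.card_filter_le _ _).trans (by simp))
    _ ≤ ((m + 1 : ℕ) : ℝ≥0∞) * 1 := by
        rw [lintegral_const_mul _ measurable_const]
        gcongr
        exact gibbs_univ_le_one hS hh hβ m
    _ = _ := mul_one _

/-! ### The local law on the microscopic scale. -/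

theorem prod_max_mul_siteWeight {Sig : Set ℂ} {Δ : ℝ} {h : ℂ → ℝ} {β : ℝ} (hβ : 0 < β) {m : ℕ}
    (x : Fin m → ℂ) {w : ℂ} {ρ : ℝ} (hρ : 0 < ρ) (hw : w ∈ Sig) :
    (∏ j, ENNReal.ofReal (max ρ ‖w - x j‖) ^ (2 * β))
        * siteWeight (potential Sig Δ h) (β * (m + 1)) w
      = ENNReal.ofReal (Real.exp ((∑ j, 2 * β * Real.log (max ρ ‖w - x j‖))
          - β * (m + 1) * (Δ * ‖w‖ ^ 2 + h w))) := by
  rw [siteWeight_potential (by positivity), Set.indicator_of_mem hw, sub_eq_add_neg, Real.exp_add,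
    ENNReal.ofReal_mul (Real.exp_pos _).le, Real.exp_sum,
    ENNReal.ofReal_prod_of_nonneg fun _ _ => (Real.exp_pos _).le]
  congr 1
  refine Finset.prod_congr rfl fun j _ => ?_
  have hpos : 0 < max ρ ‖w - x j‖ := lt_max_of_lt_left hρ
  rw [ENNReal.ofReal_rpow_of_pos hpos, Real.rpow_def_of_pos hpos, mul_comm]

/-- The exponential prefactor is the whole cost of the move: the mean of `Q` over the circle exceeds
its value at the centre by `Δ ρ²`. -/
theorem prod_max_mul_siteWeight_le {Sig : Set ℂ} {Δ : ℝ} {h : ℂ → ℝ}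
    (hh : InnerProductSpace.HarmonicOnNhd h Sig) {β : ℝ} (hβ : 0 < β) {m : ℕ}
    (x : Fin m → ℂ) {w : ℂ} {ρ : ℝ} (hρ : 0 < ρ) (hw : Metric.closedBall w ρ ⊆ Sig) :
    (∏ j, ENNReal.ofReal (max ρ ‖w - x j‖) ^ (2 * β))
        * siteWeight (potential Sig Δ h) (β * (m + 1)) w
      ≤ ENNReal.ofReal (Real.exp (β * ((m + 1) * Δ * ρ ^ 2)))
        * ∫⁻ θ, condWeight (potential Sig Δ h) β (circleMap w ρ θ) x ∂angleMeasure := by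
  refine le_trans (le_of_eq ?_) (mul_le_mul_right
    (condWeight_isotropic_average (Δ := Δ) hh hβ x hρ hw) _)
  rw [prod_max_mul_siteWeight hβ x hρ (hw (Metric.mem_closedBall_self hρ.le)),
    ← ENNReal.ofReal_mul (Real.exp_pos _).le, ← Real.exp_add]
  congr 2
  ring

theorem condWeight_le_prod_max (Q : ℂ → EReal) {β : ℝ} (hβ : 0 < β) {m : ℕ} (x : Fin m → ℂ)
    (q : ℂ) (ρ : ℝ) :
    condWeight Q β q x ≤ (∏ j, ENNReal.ofReal (max ρ ‖q - x j‖) ^ (2 * β))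
      * siteWeight Q (β * (m + 1)) q := by
  rw [condWeight]
  gcongr with j _
  rw [edist_eq_enorm_sub, ← ofReal_norm]
  exact ENNReal.ofReal_le_ofReal (le_max_right _ _)

/-- Crowding of the disc `closedBall p r` around the particle `q` makes moving `q` to the circle of
radius `4 r` favourable. -/
theorem condWeight_mul_pow_pointCount_le {Sig : Set ℂ} {Δ : ℝ} {h : ℂ → ℝ}
    (hh : InnerProductSpace.HarmonicOnNhd h Sig) {β : ℝ} (hβ : 0 < β) {m : ℕ}
    (x : Fin m → ℂ) {p q : ℂ} {r : ℝ} (hr : 0 < r) (hq : q ∈ Metric.closedBall p r)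
    (hw : Metric.closedBall q (4 * r) ⊆ Sig) :
    condWeight (potential Sig Δ h) β q x * ((2 : ℝ≥0∞) ^ (2 * β)) ^ pointCount p r x
      ≤ ENNReal.ofReal (Real.exp (β * ((m + 1) * Δ * (4 * r) ^ 2)))
        * ∫⁻ θ, condWeight (potential Sig Δ h) β (circleMap q (4 * r) θ) x ∂angleMeasure := by
  classical
  refine le_trans ?_ (prod_max_mul_siteWeight_le hh hβ x (by positivity) hw)
  rw [condWeight, mul_right_comm, pointCount, ← Finset.prod_const, Finset.prod_filter,
    ← Finset.prod_mul_distrib]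
  gcongr with j _
  rw [edist_eq_enorm_sub, ← ofReal_norm]
  split_ifs with hj
  · rw [← ENNReal.mul_rpow_of_nonneg _ _ (by positivity)]
    refine ENNReal.rpow_le_rpow ?_ (by positivity)
    -- Two points of the disc are at distance at most `2 r`, whereas the averaged move acts as if
    -- the distance were at least `4 r`: a factor `2` for each crowding particle.
    have h1 : ‖q - x j‖ ≤ 2 * r := by
      have h2 := dist_triangle_right q (x j) p
      rw [dist_eq_norm] at h2
      rw [Metric.mem_closedBall] at hq hj
      linarith
    have h3 : (2 : ℝ≥0∞) = ENNReal.ofReal 2 := by simp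
    rw [h3, ← ENNReal.ofReal_mul (norm_nonneg _)]
    refine ENNReal.ofReal_le_ofReal (le_max_of_le_left ?_)
    linarith
  · rw [mul_one]
    exact ENNReal.rpow_le_rpow (ENNReal.ofReal_le_ofReal (le_max_right _ _)) (by positivity)

/-- At a fixed angle the move is a translation, so it preserves area and carries discs to discs. -/
theorem setLIntegral_closedBall_circleMap (f : ℂ → ℝ≥0∞) (p : ℂ) (r R θ : ℝ) :
    ∫⁻ q in Metric.closedBall p r, f (circleMap q R θ) ∂area
      = ∫⁻ q in Metric.closedBall (circleMap p R θ) r, f q ∂area := by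
  have hc : ∀ s : ℂ, MeasurableSet (Metric.closedBall s r) :=
    fun s => Metric.isClosed_closedBall.measurableSet
  have hq : ∀ q : ℂ, circleMap q R θ = q + circleMap 0 R θ := fun q => by simp [circleMap]
  rw [← lintegral_indicator (hc _), ← lintegral_indicator (hc _),
    ← lintegral_add_right_eq_self
    ((Metric.closedBall (circleMap p R θ) r).indicator f) (circleMap 0 R θ)]
  refine lintegral_congr fun q => ?_
  have hiff : q + circleMap 0 R θ ∈ Metric.closedBall (circleMap p R θ) r
      ↔ q ∈ Metric.closedBall p r := by
    rw [hq p, Metric.mem_closedBall, Metric.mem_closedBall, dist_add_right]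
  by_cases hm : q ∈ Metric.closedBall p r
  · rw [Set.indicator_of_mem hm, Set.indicator_of_mem (hiff.2 hm), hq]
  · rw [Set.indicator_of_notMem hm, Set.indicator_of_notMem (fun h => hm (hiff.1 h))]

theorem measurable_circleMap_uncurry (R : ℝ) :
    Measurable fun y : ℂ × ℝ => circleMap y.1 R y.2 := by
  unfold circleMap
  fun_prop

theorem lintegral_circle_marginalWeight {Sig : Set ℂ} (hS : IsClosed Sig) {Δ : ℝ} {h : ℂ → ℝ}
    (hh : ContinuousOn h Sig) {β : ℝ} (hβ : 0 < β) (m : ℕ) (q : ℂ) (R : ℝ) :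
    ∫⁻ x : Fin m → ℂ, (∫⁻ θ, condWeight (potential Sig Δ h) β (circleMap q R θ) x ∂angleMeasure)
        * restWeight (potential Sig Δ h) β x ∂(areaPi m)
      = ∫⁻ θ, marginalWeight (potential Sig Δ h) β m (circleMap q R θ) ∂angleMeasure := by
  have hc : Measurable fun y : (Fin m → ℂ) × ℝ => circleMap q R y.2 := by fun_prop
  have hm : Measurable (Function.uncurry fun (x : Fin m → ℂ) (θ : ℝ) =>
      condWeight (potential Sig Δ h) β (circleMap q R θ) x
        * restWeight (potential Sig Δ h) β x) :=
    measurable_cond_mul_rest hS hh hβ hc measurable_fst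
  have hm1 : ∀ x : Fin m → ℂ, Measurable fun θ : ℝ =>
      condWeight (potential Sig Δ h) β (circleMap q R θ) x := fun x =>
    measurable_condWeight hS hh hβ (measurable_circleMap q R) measurable_const
  simp only [marginalWeight]
  rw [← lintegral_lintegral_swap hm.aemeasurable]
  refine lintegral_congr fun x => ?_
  rw [← lintegral_mul_const _ (hm1 x)]

/-- An exponential moment of the number of neighbours: the crowding inequality is integrated over
`q` and the other particles, and the angle is taken outside, where the move becomes a translation of
the disc. -/
theorem lintegral_pow_pointCount_le {Sig : Set ℂ} (hS : IsClosed Sig) {Δ : ℝ} {h : ℂ → ℝ}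
    (hh : InnerProductSpace.HarmonicOnNhd h Sig) {β : ℝ} (hβ : 0 < β) (m : ℕ) {p : ℂ} {r : ℝ}
    (hr : 0 < r) (hp : Metric.closedBall p (8 * r) ⊆ Sig) :
    ∫⁻ q in Metric.closedBall p r, ∫⁻ x : Fin m → ℂ,
        ((2 : ℝ≥0∞) ^ (2 * β)) ^ pointCount p r x * (condWeight (potential Sig Δ h) β q x
          * restWeight (potential Sig Δ h) β x) ∂(areaPi m) ∂area
      ≤ ENNReal.ofReal (Real.exp (β * ((m + 1) * Δ * (4 * r) ^ 2)))
        * ∫⁻ θ, ∫⁻ q in Metric.closedBall (circleMap p (4 * r) θ) r,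
            marginalWeight (potential Sig Δ h) β m q ∂area ∂angleMeasure := by
  have hc := continuousOn_of_harmonicOnNhd hh
  set K := ENNReal.ofReal (Real.exp (β * ((m + 1) * Δ * (4 * r) ^ 2)))
  have hM := measurable_marginalWeight (Δ := Δ) hS hc hβ m
  have hM2 : Measurable fun y : ℂ × ℝ =>
      marginalWeight (potential Sig Δ h) β m (circleMap y.1 (4 * r) y.2) :=
    hM.comp (measurable_circleMap_uncurry _)
  calc _ ≤ ∫⁻ q in Metric.closedBall p r, K *
          ∫⁻ θ, marginalWeight (potential Sig Δ h) β m (circleMap q (4 * r) θ) ∂angleMeasure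
            ∂area := by
        refine setLIntegral_mono' Metric.isClosed_closedBall.measurableSet fun q hq => ?_
        have hq2 : Metric.closedBall q (4 * r) ⊆ Sig := by
          refine (Metric.closedBall_subset_closedBall' ?_).trans hp
          rw [Metric.mem_closedBall] at hq
          linarith
        rw [← lintegral_circle_marginalWeight hS hc hβ, ← lintegral_const_mul' _ _
          ENNReal.ofReal_ne_top]
        refine lintegral_mono fun x => ?_
        rw [← mul_assoc, ← mul_assoc, mul_comm (_ ^ pointCount p r x)]
        refine mul_le_mul' ?_ le_rfl
        exact condWeight_mul_pow_pointCount_le hh hβ x hr hq hq2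
    _ = K * ∫⁻ θ, ∫⁻ q in Metric.closedBall p r,
          marginalWeight (potential Sig Δ h) β m (circleMap q (4 * r) θ) ∂area ∂angleMeasure := by
        rw [lintegral_const_mul' _ _ ENNReal.ofReal_ne_top,
          lintegral_lintegral_swap hM2.aemeasurable]
    _ = _ := by
        simp only [setLIntegral_closedBall_circleMap]

open Classical in
-- A particle in the disc sees one point fewer than the disc contains, so a single nonzero term
-- already forces the disc to hold at most `s + 1` points.
theorem sum_indicator_pointCount_le {m : ℕ} (p : ℂ) (r : ℝ) (s : ℕ) (z : Fin (m + 1) → ℂ) :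
    ∑ i, (if z i ∈ Metric.closedBall p r ∧ pointCount p r (i.removeNth z) ≤ s then
      (1 : ℝ≥0∞) else 0) ≤ s + 1 := by
  classical
  rw [Finset.sum_boole]
  by_cases hex : ∃ i, z i ∈ Metric.closedBall p r ∧ pointCount p r (i.removeNth z) ≤ s
  · obtain ⟨i, hi, his⟩ := hex
    have h1 := pointCount_removeNth hi
    have h2 : (Finset.univ.filter fun i => z i ∈ Metric.closedBall p r ∧
        pointCount p r (i.removeNth z) ≤ s).card ≤ pointCount p r z :=
      Finset.card_le_card fun j hj => by
        simp only [Finset.mem_filter] at hj ⊢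
        exact ⟨hj.1, hj.2.1⟩
    exact_mod_cast h2.trans (by omega)
  · push Not at hex
    rw [Finset.filter_false_of_mem]
    · simp
    · exact fun i _ hi => absurd (hex i hi.1) (not_lt.2 hi.2)

/-- One step of the local law: the expected number of particles in a microscopic disc is controlled
by the expected numbers in neighbouring discs, with a factor `1 / 2`. -/
theorem expectedCount_step {Sig : Set ℂ} (hS : IsClosed Sig) {Δ : ℝ} {h : ℂ → ℝ}
    (hh : InnerProductSpace.HarmonicOnNhd h Sig) {β : ℝ} (hβ : 0 < β) (m : ℕ) {p : ℂ} {r : ℝ}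
    (hr : 0 < r) (hp : Metric.closedBall p (8 * r) ⊆ Sig)
    (hrn : (m + 1) * Δ * (4 * r) ^ 2 ≤ 1) {s : ℕ} (hs : 1 / β ≤ s) {B : ℝ≥0∞}
    (hB : ∀ q, dist q p = 4 * r →
      expectedCount (potential Sig Δ h) β (m + 1) q r ≤ B) :
    expectedCount (potential Sig Δ h) β (m + 1) p r ≤ s + 1 + 2⁻¹ * B := by
  classical
  have hc := continuousOn_of_harmonicOnNhd hh
  set Q := potential Sig Δ h
  set Zi := (partitionFunction Q β (m + 1))⁻¹
  set D := Metric.closedBall p r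
  have hD : MeasurableSet D := Metric.isClosed_closedBall.measurableSet
  set K := ENNReal.ofReal (Real.exp β)
  have hK0 : K ≠ 0 := (ENNReal.ofReal_pos.2 (Real.exp_pos _)).ne'
  have hKt : K ≠ ⊤ := ENNReal.ofReal_ne_top
  set c : ℝ≥0∞ := (2 : ℝ≥0∞) ^ (2 * β)
  -- For `k ≥ 1 / β + 1` the gain `2 ^ (2 β k)` is at least twice the cost `e^β`, as `2 log 2 ≥ 1`.
  -- This is the source of the factor `1 / 2`.
  have hcK : ∀ k : ℕ, ¬ k ≤ s → 2 * K ≤ c ^ k := by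
    intro k hk
    have hk' : 1 / β + 1 ≤ (k : ℝ) := by
      have : (s : ℝ) + 1 ≤ k := by exact_mod_cast (by omega : s + 1 ≤ k)
      linarith
    have h2 : (2 : ℝ≥0∞) = ENNReal.ofReal 2 := by simp
    have hbk : 1 + β ≤ β * k := by
      calc 1 + β = β * (1 / β + 1) := by field_simp
        _ ≤ _ := by gcongr
    have hl : 2 * Real.log 2 ≥ 1 := by linarith [Real.log_two_gt_d9]
    rw [← ENNReal.rpow_mul_natCast, h2, ← ENNReal.ofReal_mul (by norm_num),
      ENNReal.ofReal_rpow_of_pos (by norm_num)]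
    refine ENNReal.ofReal_le_ofReal ?_
    rw [Real.rpow_def_of_pos (by norm_num)]
    calc 2 * Real.exp β = Real.exp (Real.log 2 + β) := by
          rw [Real.exp_add, Real.exp_log (by norm_num)]
      _ ≤ _ := by
          refine Real.exp_le_exp.2 ?_
          nlinarith [Real.log_two_lt_d9]
  set W : ℂ → (Fin m → ℂ) → ℝ≥0∞ := fun q x => condWeight Q β q x * restWeight Q β x with hW
  set φ : ℂ → (Fin m → ℂ) → ℝ≥0∞ := fun q x =>
    if q ∈ D ∧ pointCount p r x ≤ s then 1 else 0 with hφ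
  have hpc : Measurable fun x : Fin m → ℂ => pointCount p r x := measurable_pointCount p r
  have hφm : Measurable fun y : ℂ × (Fin m → ℂ) => φ y.1 y.2 := by
    refine Measurable.ite (MeasurableSet.inter (measurable_fst hD) ?_) measurable_const
      measurable_const
    exact (hpc.comp measurable_snd) (measurableSet_Iic (a := s))
  have hWm : Measurable fun y : ℂ × (Fin m → ℂ) => W y.1 y.2 :=
    measurable_cond_mul_rest hS hc hβ measurable_fst measurable_snd
  have hA : Zi * ((m + 1) * ∫⁻ q, ∫⁻ x, φ q x * W q x ∂(areaPi m) ∂area) ≤ s + 1 := by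
    rw [← lintegral_gibbs_sum hS hc hβ m hφm]
    calc _ ≤ ∫⁻ _, ((s : ℝ≥0∞) + 1) * 1 ∂(gibbs Q β (m + 1)) :=
          lintegral_mono fun z => by
            rw [mul_one]
            exact sum_indicator_pointCount_le p r s z
      _ ≤ (s + 1) * 1 := by
          rw [lintegral_const_mul _ measurable_const]
          gcongr
          exact gibbs_univ_le_one hS hc hβ m
      _ = _ := mul_one _
  -- Configurations with at most `s` neighbours are kept; on the others Markov's inequality is used
  -- in the form `1 ≤ (2 * K)⁻¹ * c ^ k`.
  have hsplit : ∫⁻ q in D, marginalWeight Q β m q ∂area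
      ≤ (∫⁻ q, ∫⁻ x, φ q x * W q x ∂(areaPi m) ∂area)
        + (2 * K)⁻¹ * ∫⁻ q in D, ∫⁻ x, c ^ pointCount p r x * W q x ∂(areaPi m) ∂area := by
    have hm1 : Measurable fun q => ∫⁻ x, φ q x * W q x ∂(areaPi m) :=
      (hφm.mul hWm).lintegral_prod_right'
    have hKi : (2 * K)⁻¹ ≠ ⊤ := ENNReal.inv_ne_top.2 (mul_ne_zero two_ne_zero hK0)
    rw [← lintegral_const_mul' _ _ hKi]
    refine le_trans ?_ (add_le_add_left (setLIntegral_le_lintegral D _) _)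
    rw [← lintegral_add_left hm1]
    refine setLIntegral_mono' hD fun q hq => ?_
    have hm2 : Measurable fun x => φ q x * W q x := (hφm.mul hWm).comp measurable_prodMk_left
    rw [← lintegral_const_mul' _ _ hKi, ← lintegral_add_left hm2]
    refine lintegral_mono fun x => ?_
    simp only [hφ]
    by_cases hx : pointCount p r x ≤ s
    · rw [if_pos ⟨hq, hx⟩, one_mul]
      exact le_self_add
    · rw [if_neg (fun h => hx h.2), zero_mul, zero_add, ← mul_assoc]
      refine le_mul_of_one_le_left' ?_
      rw [← ENNReal.inv_mul_cancel (mul_ne_zero two_ne_zero hK0)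
        (ENNReal.mul_ne_top ENNReal.ofNat_ne_top hKt)]
      gcongr
      exact hcK _ hx
  have hcrowd : ∫⁻ q in D, ∫⁻ x, c ^ pointCount p r x * W q x ∂(areaPi m) ∂area
      ≤ K * ∫⁻ θ, ∫⁻ q in Metric.closedBall (circleMap p (4 * r) θ) r,
            marginalWeight Q β m q ∂area ∂angleMeasure := by
    refine (lintegral_pow_pointCount_le hS hh hβ m hr hp).trans ?_
    gcongr
    refine ENNReal.ofReal_le_ofReal (Real.exp_le_exp.2 ?_)
    nlinarith
  have hBθ : Zi * ((m + 1) * ∫⁻ θ, ∫⁻ q in Metric.closedBall (circleMap p (4 * r) θ) r,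
      marginalWeight Q β m q ∂area ∂angleMeasure) ≤ B := by
    have hM2 : Measurable fun θ : ℝ => ∫⁻ q in Metric.closedBall (circleMap p (4 * r) θ) r,
        marginalWeight Q β m q ∂area := by
      simp only [← setLIntegral_closedBall_circleMap]
      have : Measurable fun y : ℝ × ℂ => marginalWeight Q β m (circleMap y.2 (4 * r) y.1) :=
        (measurable_marginalWeight hS hc hβ m).comp
          ((measurable_circleMap_uncurry _).comp measurable_swap)
      exact this.lintegral_prod_right'
    rw [← lintegral_const_mul _ hM2, ← lintegral_const_mul _ (hM2.const_mul _)]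
    calc _ ≤ ∫⁻ _, B ∂angleMeasure := by
          refine lintegral_mono fun θ => ?_
          rw [← expectedCount_eq hS hc hβ]
          refine hB _ ?_
          rw [dist_eq_norm, circleMap_sub_center, norm_circleMap_zero, abs_of_pos (by positivity)]
      _ = B := by simp
  rw [expectedCount_eq hS hc hβ]
  calc Zi * ((m + 1) * ∫⁻ q in D, marginalWeight Q β m q ∂area)
      ≤ Zi * ((m + 1) * ((∫⁻ q, ∫⁻ x, φ q x * W q x ∂(areaPi m) ∂area)
        + (2 * K)⁻¹ * (K * ∫⁻ θ, ∫⁻ q in Metric.closedBall (circleMap p (4 * r) θ) r,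
            marginalWeight Q β m q ∂area ∂angleMeasure))) := by
        gcongr
        exact hsplit.trans (by gcongr)
    _ = Zi * ((m + 1) * ∫⁻ q, ∫⁻ x, φ q x * W q x ∂(areaPi m) ∂area)
        + 2⁻¹ * (Zi * ((m + 1) * ∫⁻ θ, ∫⁻ q in Metric.closedBall (circleMap p (4 * r) θ) r,
            marginalWeight Q β m q ∂area ∂angleMeasure)) := by
        have : (2 * K)⁻¹ * K = 2⁻¹ := by
          rw [ENNReal.mul_inv (Or.inl two_ne_zero) (Or.inl ENNReal.ofNat_ne_top), mul_assoc,
            ENNReal.inv_mul_cancel hK0 hKt, mul_one]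
        rw [← mul_assoc (2 * K)⁻¹, this]
        ring
    _ ≤ _ := by gcongr

/-- Local law: far from the boundary of `Sig`, on the microscopic scale. -/
theorem expectedCount_le {Sig : Set ℂ} (hS : IsClosed Sig) {Δ : ℝ} {h : ℂ → ℝ}
    (hh : InnerProductSpace.HarmonicOnNhd h Sig) {β : ℝ} (hβ : 0 < β) (m : ℕ) {r : ℝ}
    (hr : 0 < r) (hrn : (m + 1) * Δ * (4 * r) ^ 2 ≤ 1) {s : ℕ} (hs : 1 / β ≤ s) (j : ℕ) :
    ∀ p : ℂ, Metric.closedBall p (8 * r * j) ⊆ Sig →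
    expectedCount (potential Sig Δ h) β (m + 1) p r
      ≤ 2 * (s + 1) + 2⁻¹ ^ j * (m + 1 : ℕ) := by
  have hc := continuousOn_of_harmonicOnNhd hh
  induction j with
  | zero =>
    intro p _
    rw [pow_zero, one_mul]
    exact (expectedCount_le_card hS hc hβ m p r).trans le_add_self
  | succ j ih =>
    intro p hp
    push_cast at hp
    have h8 : Metric.closedBall p (8 * r) ⊆ Sig := by
      refine (Metric.closedBall_subset_closedBall ?_).trans hp
      nlinarith [mul_nonneg hr.le (Nat.cast_nonneg (α := ℝ) j)]
    -- The value `2 * (s + 1)` is the fixed point of `B ↦ s + 1 + B / 2`, so only the excess over it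
    -- is halved at each step.
    refine (expectedCount_step hS hh hβ m hr h8 hrn hs fun q hq => ih q ?_).trans (le_of_eq ?_)
    · refine (Metric.closedBall_subset_closedBall' ?_).trans hp
      rw [hq]
      nlinarith
    · rw [mul_add, ← mul_assoc, ENNReal.inv_mul_cancel two_ne_zero ENNReal.ofNat_ne_top, pow_succ]
      ring

/-! ### Logarithmic potentials as competitors in the obstacle problem. -/

/-- Continuous subharmonic functions that grow at most like `L log |w|` at infinity and are
Lipschitz continuous with constant `K`. -/
structure IsLogPotential (L K : ℝ) (u : ℂ → ℝ) : Prop where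
  continuous : Continuous u
  le_circleAverage : ∀ (c : ℂ) (r : ℝ), 0 < r → u c ≤ Real.circleAverage u c r
  growth : ∃ A : ℝ, ∀ᶠ w in Bornology.cobounded ℂ, u w ≤ L * Real.log ‖w‖ + A
  le_add_dist : ∀ z w, u z ≤ u w + K * dist z w

namespace IsLogPotential

theorem add {L₁ L₂ K₁ K₂ : ℝ} {u v : ℂ → ℝ} (hu : IsLogPotential L₁ K₁ u)
    (hv : IsLogPotential L₂ K₂ v) :
    IsLogPotential (L₁ + L₂) (K₁ + K₂) (fun z => u z + v z) where
  continuous := hu.continuous.add hv.continuous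
  le_circleAverage c r hr := by
    rw [Real.circleAverage_fun_add hu.continuous.continuousOn.circleIntegrable'
      hv.continuous.continuousOn.circleIntegrable']
    exact add_le_add (hu.le_circleAverage c r hr) (hv.le_circleAverage c r hr)
  growth := by
    obtain ⟨A, hA⟩ := hu.growth
    obtain ⟨B, hB⟩ := hv.growth
    refine ⟨A + B, ?_⟩
    filter_upwards [hA, hB] with w h1 h2
    linarith
  le_add_dist z w := by linarith [hu.le_add_dist z w, hv.le_add_dist z w]

theorem const_mul {L K : ℝ} {u : ℂ → ℝ} (hu : IsLogPotential L K u) {a : ℝ} (ha : 0 ≤ a) :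
    IsLogPotential (a * L) (a * K) (fun z => a * u z) where
  continuous := continuous_const.mul hu.continuous
  le_circleAverage c r hr := by
    have := Real.circleAverage_fun_smul (a := a) (f := u) (c := c) (R := r)
    simp only [smul_eq_mul] at this
    rw [this]
    exact mul_le_mul_of_nonneg_left (hu.le_circleAverage c r hr) ha
  growth := by
    obtain ⟨A, hA⟩ := hu.growth
    refine ⟨a * A, ?_⟩
    filter_upwards [hA] with w h1
    calc a * u w ≤ a * (L * Real.log ‖w‖ + A) := mul_le_mul_of_nonneg_left h1 ha
      _ = _ := by ring
  le_add_dist z w := by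
    calc a * u z ≤ a * (u w + K * dist z w) := mul_le_mul_of_nonneg_left (hu.le_add_dist z w) ha
      _ = _ := by ring

theorem zero : IsLogPotential 0 0 (fun _ => 0) where
  continuous := continuous_const
  le_circleAverage c r _ := by rw [Real.circleAverage_const]
  growth := ⟨0, by simp⟩
  le_add_dist z w := by simp

theorem mono {L L' K : ℝ} {u : ℂ → ℝ} (hu : IsLogPotential L K u) (hL : L ≤ L') :
    IsLogPotential L' K u where
  continuous := hu.continuous
  le_circleAverage := hu.le_circleAverage
  growth := by
    obtain ⟨A, hA⟩ := hu.growth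
    refine ⟨A, ?_⟩
    filter_upwards [hA, eventually_cobounded_le_norm (E := ℂ) 1] with w h1 h2
    have := mul_le_mul_of_nonneg_right hL (Real.log_nonneg h2)
    linarith
  le_add_dist := hu.le_add_dist

theorem sum {ι : Type*} (s : Finset ι) {L K : ℝ} {u : ι → ℂ → ℝ}
    (hu : ∀ i ∈ s, IsLogPotential L K (u i)) :
    IsLogPotential (s.card * L) (s.card * K) (fun z => ∑ i ∈ s, u i z) := by
  classical
  induction s using Finset.induction_on with
  | empty => simpa using zero
  | insert a s ha ih =>
    have h1 := (hu a (Finset.mem_insert_self a s)).add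
      (ih fun i hi => hu i (Finset.mem_insert_of_mem hi))
    simp only [Finset.sum_insert ha, Finset.card_insert_of_notMem ha]
    push_cast
    rw [add_mul, add_mul, one_mul, one_mul, add_comm _ L, add_comm _ K]
    exact h1

end IsLogPotential

/-- A maximum of two subharmonic functions. The truncation at `ρ` makes it Lipschitz, which permits
replacing the coincidence set by a finite net. -/
theorem isLogPotential_log_max (a : ℂ) {ρ : ℝ} (hρ : 0 < ρ) :
    IsLogPotential 1 (1 / ρ) (fun z => Real.log (max ρ ‖z - a‖)) := by
  have hpos : ∀ z : ℂ, 0 < max ρ ‖z - a‖ := fun z => lt_max_of_lt_left hρ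
  have hcont : Continuous fun z : ℂ => Real.log (max ρ ‖z - a‖) :=
    Continuous.log (by fun_prop) fun z => (hpos z).ne'
  refine ⟨hcont, fun c r hr => ?_, ⟨Real.log 2, ?_⟩, fun z w => ?_⟩
  · have hint : CircleIntegrable (fun z => Real.log (max ρ ‖z - a‖)) c r :=
      hcont.continuousOn.circleIntegrable'
    rcases le_total ‖c - a‖ ρ with hc | hc
    · rw [max_eq_left hc]
      conv_lhs => rw [← Real.circleAverage_const (Real.log ρ) c r]
      refine Real.circleAverage_mono (circleIntegrable_const _ _ _) hint fun z _ => ?_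
      exact Real.log_le_log hρ (le_max_left _ _)
    · rw [max_eq_right hc]
      have hca : 0 < ‖c - a‖ := hρ.trans_le hc
      calc Real.log ‖c - a‖ ≤ Real.log (max r ‖c - a‖) := Real.log_le_log hca (le_max_right _ _)
        _ = Real.circleAverage (fun z => Real.log ‖z - a‖) c r :=
            (circleAverage_log_norm_sub a c hr).symm
        _ ≤ _ := by
            rw [← integral_angleMeasure, ← integral_angleMeasure]
            refine integral_mono_ae
              (integrable_angleMeasure (circleIntegrable_log_norm_sub_const r))
              (integrable_angleMeasure hint) ?_
            -- At `z = a` the comparison may fail, since `Real.log 0 = 0` can exceed `log ρ`.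
            filter_upwards [ae_circleMap_ne a c hr.ne'] with θ hθ
            exact Real.log_le_log (norm_pos_iff.2 (sub_ne_zero.2 hθ)) (le_max_right _ _)
  · filter_upwards [eventually_cobounded_le_norm (E := ℂ) (‖a‖ + ρ)] with w hw
    have hw0 : 0 < ‖w‖ := by linarith [norm_nonneg a]
    rw [one_mul, add_comm, ← Real.log_mul two_ne_zero hw0.ne']
    refine Real.log_le_log (hpos w) (max_le ?_ ?_)
    · linarith [norm_nonneg a]
    · linarith [norm_sub_le w a]
  · have h1 : max ρ ‖z - a‖ ≤ max ρ ‖w - a‖ * (1 + dist z w / ρ) := by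
      have h2 : ρ ≤ max ρ ‖w - a‖ := le_max_left _ _
      have h3 : ‖w - a‖ ≤ max ρ ‖w - a‖ := le_max_right _ _
      have h4 : dist z w ≤ max ρ ‖w - a‖ * (dist z w / ρ) := by
        calc dist z w = ρ * (dist z w / ρ) := by field_simp
          _ ≤ _ := by gcongr
      have h5 : ‖z - a‖ ≤ dist z w + ‖w - a‖ := by
        rw [dist_eq_norm]; exact norm_sub_le_norm_sub_add_norm_sub z w a
      have h6 : 0 ≤ dist z w := dist_nonneg
      refine max_le ?_ ?_ <;> linarith
    have h7 : (0 : ℝ) < 1 + dist z w / ρ := by positivity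
    calc Real.log (max ρ ‖z - a‖) ≤ Real.log (max ρ ‖w - a‖ * (1 + dist z w / ρ)) :=
          Real.log_le_log (hpos z) h1
      _ = Real.log (max ρ ‖w - a‖) + Real.log (1 + dist z w / ρ) :=
          Real.log_mul (hpos w).ne' h7.ne'
      _ ≤ Real.log (max ρ ‖w - a‖) + 1 / ρ * dist z w := by
          have := Real.log_le_sub_one_of_pos h7
          gcongr
          calc _ ≤ _ := this
            _ = _ := by ring

theorem potential_of_mem {Sig : Set ℂ} {Δ : ℝ} {h : ℂ → ℝ} {z : ℂ} (hz : z ∈ Sig) :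
    potential Sig Δ h z = ((Δ * ‖z‖ ^ 2 + h z : ℝ) : EReal) := by
  rw [potential, if_pos hz]

theorem obstacle_le (Q : ℂ → EReal) (z : ℂ) : obstacle Q z ≤ Q z :=
  sSup_le fun _ ⟨_, hs, hx⟩ => hx ▸ hs.2.1 z

/-- The maximum over `Sig` of `u - Q`, for `u` a competitor up to a constant, is attained at a point
of the coincidence set. -/
theorem IsLogPotential.exists_mem_coincidenceSet {Sig : Set ℂ} (hS : IsCompact Sig)
    (hne : Sig.Nonempty) {Δ : ℝ} {h : ℂ → ℝ} (hh : ContinuousOn h Sig) {K : ℝ} {u : ℂ → ℝ}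
    (hu : IsLogPotential 2 K u) :
    ∃ w ∈ Sig, w ∈ coincidenceSet (potential Sig Δ h) ∧
      ∀ p, ((u p - (u w - (Δ * ‖w‖ ^ 2 + h w)) : ℝ) : EReal)
        ≤ obstacle (potential Sig Δ h) p := by
  have hcont : ContinuousOn (fun z => u z - (Δ * ‖z‖ ^ 2 + h z)) Sig := by
    have := hu.continuous
    fun_prop
  obtain ⟨w, hw, hmax⟩ := hS.exists_isMaxOn hne hcont
  set M := u w - (Δ * ‖w‖ ^ 2 + h w) with hM
  -- By the choice of `M`, the function `u - M` lies below `Q` and touches it at `w`; being a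
  -- competitor, it forces the obstacle to equal `Q` there.
  have hcomp : IsCompetitor (potential Sig Δ h) (fun z => ((u z - M : ℝ) : EReal)) := by
    refine ⟨⟨?_, fun z => EReal.coe_ne_top _, fun c r hr g hg hle => ?_⟩, fun z => ?_, ?_⟩
    · exact (continuous_coe_real_ereal.comp
        (hu.continuous.sub continuous_const)).upperSemicontinuous
    · have hu' : ContinuousOn (fun z => u z - M) (Metric.sphere c |r|) :=
        (hu.continuous.sub continuous_const).continuousOn
      have havg : Real.circleAverage (fun z => u z - M) c r = Real.circleAverage u c r - M := by
        rw [Real.circleAverage_fun_sub hu.continuous.continuousOn.circleIntegrable'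
          (circleIntegrable_const _ _ _), Real.circleAverage_const]
      refine EReal.coe_le_coe_iff.2 ?_
      calc u c - M ≤ Real.circleAverage u c r - M := by
            linarith [hu.le_circleAverage c r hr]
        _ = Real.circleAverage (fun z => u z - M) c r := havg.symm
        _ ≤ Real.circleAverage g c r := by
            rw [← abs_of_pos hr] at hg
            refine Real.circleAverage_mono hu'.circleIntegrable' hg.circleIntegrable' ?_
            intro z hz
            rw [abs_of_pos hr] at hz
            exact EReal.coe_le_coe_iff.1 (hle z hz)
    · by_cases hz : z ∈ Sig
      · rw [potential_of_mem hz]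
        refine EReal.coe_le_coe_iff.2 ?_
        have : u z - (Δ * ‖z‖ ^ 2 + h z) ≤ M := hmax hz
        linarith
      · rw [potential, if_neg hz]
        exact le_top
    · obtain ⟨A, hA⟩ := hu.growth
      refine ⟨A - M, ?_⟩
      filter_upwards [hA] with z hz
      refine EReal.coe_le_coe_iff.2 ?_
      linarith
  have hle : ∀ p, ((u p - M : ℝ) : EReal) ≤ obstacle (potential Sig Δ h) p :=
    fun p => le_sSup ⟨_, hcomp, rfl⟩
  refine ⟨w, hw, ?_, hle⟩
  refine le_antisymm ?_ (obstacle_le _ w)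
  refine le_trans (le_of_eq ?_) (hle w)
  rw [potential_of_mem hw, hM]
  congr 1
  ring

/-- Finite from below because a constant competes, from above because the obstacle lies below `Q`.
-/
theorem exists_obstacle_eq_coe {Sig : Set ℂ} (hS : IsCompact Sig) {Δ : ℝ} {h : ℂ → ℝ}
    (hh : ContinuousOn h Sig) {p : ℂ} (hp : p ∈ Sig) :
    ∃ o : ℝ, obstacle (potential Sig Δ h) p = o ∧ o ≤ Δ * ‖p‖ ^ 2 + h p := by
  obtain ⟨w, -, -, hw⟩ := (IsLogPotential.zero.mono zero_le_two).exists_mem_coincidenceSet hS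
    ⟨p, hp⟩ (Δ := Δ) hh
  have h1 := obstacle_le (potential Sig Δ h) p
  rw [potential_of_mem hp] at h1
  have h2 := hw p
  generalize obstacle (potential Sig Δ h) p = o at *
  induction o with
  | bot => exact absurd (le_bot_iff.1 h2) (EReal.coe_ne_bot _)
  | top => exact absurd (top_le_iff.1 h1) (EReal.coe_ne_top _)
  | coe o => exact ⟨o, rfl, EReal.coe_le_coe_iff.1 h1⟩

/-! ### Minimax and the discrete harmonic measure. -/

/-- Minimax: if every vector of a convex set has a nonnegative coordinate, then some weighted mean
of the coordinates is nonnegative on the set. -/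
theorem exists_weights_sum_nonneg {ι : Type*} [Fintype ι] {A : Set (ι → ℝ)} (hA : Convex ℝ A)
    (hne : A.Nonempty) (h : ∀ v ∈ A, ∃ i, 0 ≤ v i) :
    ∃ ν : ι → ℝ, (∀ i, 0 ≤ ν i) ∧ ∑ i, ν i = 1 ∧ ∀ v ∈ A, 0 ≤ ∑ i, ν i * v i := by
  classical
  set N : Set (ι → ℝ) := {v | ∀ i, v i < 0} with hN
  have hNeq : N = Set.univ.pi fun _ => Set.Iio 0 := by ext; simp [hN]
  have hNc : Convex ℝ N := by
    rw [hNeq]; exact convex_pi fun i _ => convex_Iio 0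
  have hNo : IsOpen N := by
    rw [hNeq]; exact isOpen_set_pi Set.finite_univ fun i _ => isOpen_Iio
  have hdisj : Disjoint N A := Set.disjoint_left.2 fun v hv hvA => by
    obtain ⟨i, hi⟩ := h v hvA
    exact absurd (hv i) (not_lt.2 hi)
  -- `A` is separated from the open negative orthant. As `0` is in the closure of the orthant, `t ≥
  -- 0`; as the orthant is unbounded in every negative coordinate direction, the coefficients of `f`
  -- are nonnegative.
  obtain ⟨f, t, hfN, hfA⟩ := geometric_hahn_banach_open hNc hNo hA hdisj
  set ν : ι → ℝ := fun i => f (Pi.single i 1) with hν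
  have hf : ∀ v, f v = ∑ i, ν i * v i := by
    intro v
    conv_lhs => rw [← Finset.univ_sum_single v, map_sum]
    refine Finset.sum_congr rfl fun i _ => ?_
    have : (Pi.single i (v i) : ι → ℝ) = v i • Pi.single i (1 : ℝ) := by
      rw [← Pi.single_smul, smul_eq_mul, mul_one]
    rw [this, map_smul, smul_eq_mul, mul_comm]
  have ht : 0 ≤ t := by
    by_contra hlt
    push Not at hlt
    have hmem : ∀ ε : ℝ, 0 < ε → -(ε * f 1) < t := by
      intro ε hε
      have := hfN (-(ε • 1)) (fun i => by simp [hε])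
      rwa [map_neg, map_smul, smul_eq_mul] at this
    have h1 := hmem (-t / (2 * (|f 1| + 1))) (by
      have := abs_nonneg (f 1)
      exact div_pos (by linarith) (by positivity))
    have h2 : -t / (2 * (|f 1| + 1)) * f 1 ≤ -t / 2 := by
      have h3 : f 1 ≤ |f 1| + 1 := by linarith [le_abs_self (f 1)]
      have h4 : 0 < |f 1| + 1 := by linarith [abs_nonneg (f 1)]
      calc -t / (2 * (|f 1| + 1)) * f 1 ≤ -t / (2 * (|f 1| + 1)) * (|f 1| + 1) := by
            refine mul_le_mul_of_nonneg_left h3 (div_nonneg (by linarith) (by positivity))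
        _ = _ := by field_simp
    linarith
  have hν0 : ∀ i, 0 ≤ ν i := by
    intro i
    by_contra hlt
    push Not at hlt
    have hmem : ∀ s : ℝ, 0 < s → -f 1 - s * ν i < t := by
      intro s hs
      have := hfN (-1 - s • Pi.single i (1 : ℝ)) (fun j => by
        have : 0 ≤ (Pi.single i (1 : ℝ) : ι → ℝ) j := by
          rw [Pi.single_apply]; split_ifs <;> norm_num
        simp only [Pi.sub_apply, Pi.neg_apply, Pi.one_apply, Pi.smul_apply, smul_eq_mul]
        nlinarith)
      rwa [map_sub, map_neg, map_smul, smul_eq_mul] at this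
    have h1 := hmem ((|t + f 1| + 1) / -ν i) (div_pos (by positivity) (by linarith))
    have h2 : (|t + f 1| + 1) / -ν i * ν i = -(|t + f 1| + 1) := by
      rw [div_neg, neg_mul, div_mul_cancel₀ _ hlt.ne]
    linarith [le_abs_self (t + f 1)]
  have hs0 : 0 ≤ ∑ i, ν i := Finset.sum_nonneg fun i _ => hν0 i
  have hs : 0 < ∑ i, ν i := by
    refine lt_of_le_of_ne hs0 fun heq => ?_
    have hz : ∀ i, ν i = 0 := fun i =>
      (Finset.sum_eq_zero_iff_of_nonneg fun i _ => hν0 i).1 heq.symm i (Finset.mem_univ i)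
    have hfz : ∀ v, f v = 0 := fun v => by rw [hf]; simp [hz]
    obtain ⟨v, hv⟩ := hne
    have h1 := hfA v hv
    have h2 := hfN (-1) (fun i => by simp)
    rw [hfz] at h1 h2
    linarith
  refine ⟨fun i => ν i / ∑ j, ν j, fun i => div_nonneg (hν0 i) hs0, ?_, fun v hv => ?_⟩
  · rw [← Finset.sum_div, div_self hs.ne']
  · have h1 := (ht.trans (hfA v hv))
    rw [hf] at h1
    calc 0 ≤ (∑ i, ν i * v i) / ∑ j, ν j := div_nonneg h1 hs0
      _ = _ := by
        rw [Finset.sum_div]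
        exact Finset.sum_congr rfl fun i _ => by ring

/-- A discrete substitute for the harmonic measure of the coincidence set. -/
theorem exists_weights_coincidenceSet {Sig : Set ℂ} (hS : IsCompact Sig) {Δ : ℝ} {h : ℂ → ℝ}
    (hh : ContinuousOn h Sig) {p : ℂ} (hp : p ∈ Sig) {o : ℝ}
    (ho : obstacle (potential Sig Δ h) p = o) (m : ℕ) {ρ : ℝ} (hρ : 0 < ρ) :
    ∃ (W : Finset ℂ) (ν : W → ℝ),
      (∀ w ∈ W, w ∈ Sig ∧ w ∈ coincidenceSet (potential Sig Δ h)) ∧ (∀ w, 0 ≤ ν w) ∧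
      ∑ w, ν w = 1 ∧ ∀ x : Fin m → ℂ,
        (∑ i, 2 * Real.log (max ρ ‖p - x i‖)) - (m + 1) * o - 1
          ≤ ∑ w, ν w * ((∑ i, 2 * Real.log (max ρ ‖(w : ℂ) - x i‖))
              - (m + 1) * (Δ * ‖(w : ℂ)‖ ^ 2 + h w)) := by
  set T : Set ℂ := Sig ∩ coincidenceSet (potential Sig Δ h) with hT
  set K : ℝ := m * (2 * (1 / ρ)) with hK
  have hK0 : 0 ≤ K := by positivity
  set q : ℂ → ℝ := fun z => Δ * ‖z‖ ^ 2 + h z with hq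
  have hqc : ContinuousOn q Sig := by fun_prop
  have huc := hS.uniformContinuousOn_of_continuous hqc
  rw [Metric.uniformContinuousOn_iff] at huc
  obtain ⟨δ, hδ, hδq⟩ := huc (1 / (2 * (m + 1))) (by positivity)
  -- The mesh of the net is such that `(m + 1) * q` and the potentials `u` each vary by at most `1 /
  -- 2` between a coincidence point and the net. Together they make up the loss `1` in the
  -- conclusion.
  set δ' := min δ (1 / (2 * (K + 1))) with hδ'
  have hδ'0 : 0 < δ' := lt_min hδ (by positivity)
  have htb : TotallyBounded T := hS.totallyBounded.subset Set.inter_subset_left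
  obtain ⟨W, hWT, hWfin, hWcov⟩ := Metric.finite_approx_of_totallyBounded htb δ' hδ'0
  lift W to Finset ℂ using hWfin
  -- All potentials with the given growth and Lipschitz constant are admitted, because those of
  -- point configurations do not form a convex set.
  set A : Set (W → ℝ) := {v | ∃ u, IsLogPotential (2 * (m + 1)) K u ∧
    ∀ w : W, v w = u w - u p - (m + 1) * (q w - o) + 1} with hA
  have hAconv : Convex ℝ A := by
    rintro v ⟨u, hu, hv⟩ v' ⟨u', hu', hv'⟩ a b ha hb hab
    refine ⟨fun z => a * u z + b * u' z, ?_, fun w => ?_⟩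
    · have := (hu.const_mul ha).add (hu'.const_mul hb)
      rwa [← add_mul, ← add_mul, hab, one_mul, one_mul] at this
    · have : b = 1 - a := by linarith
      subst this
      simp only [Pi.add_apply, Pi.smul_apply, smul_eq_mul, hv, hv']
      ring
  have hmem : ∀ x : Fin m → ℂ, IsLogPotential (2 * (m + 1)) K
      (fun z => ∑ i, 2 * Real.log (max ρ ‖z - x i‖)) := by
    intro x
    have := IsLogPotential.sum Finset.univ
      (fun i _ => (isLogPotential_log_max (x i) hρ).const_mul zero_le_two)
    rw [Finset.card_univ, Fintype.card_fin] at this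
    -- The `m` other particles have growth `2 m`, within the allowed `2 (m + 1)`.
    exact this.mono (by linarith)
  have hpos : ∀ v ∈ A, ∃ w, 0 ≤ v w := by
    rintro v ⟨u, hu, hv⟩
    have hu2 : IsLogPotential 2 ((1 / (m + 1)) * K) (fun z => (1 / (m + 1 : ℝ)) * u z) := by
      have := hu.const_mul (a := 1 / ((m : ℝ) + 1)) (by positivity)
      have e : 1 / ((m : ℝ) + 1) * (2 * (m + 1)) = 2 := by field_simp
      rwa [e] at this
    obtain ⟨w₀, hw₀, hw₀c, hle⟩ := hu2.exists_mem_coincidenceSet hS ⟨p, hp⟩ (Δ := Δ) hh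
    have h1 := hle p
    rw [ho, EReal.coe_le_coe_iff] at h1
    have hw₀T : w₀ ∈ T := ⟨hw₀, hw₀c⟩
    obtain ⟨w, hwW, hwd⟩ := Set.mem_iUnion₂.1 (hWcov hw₀T)
    rw [Metric.mem_ball] at hwd
    refine ⟨⟨w, hwW⟩, ?_⟩
    rw [hv]
    have hqd := hδq w₀ hw₀ w (hWT hwW).1 (hwd.trans_le (min_le_left _ _))
    rw [Real.dist_eq, abs_lt] at hqd
    have hud := hu.le_add_dist w₀ w
    have hn : (0 : ℝ) < m + 1 := by positivity
    have e1 : (m + 1 : ℝ) * (1 / (m + 1) * u p - (1 / (m + 1) * u w₀ - q w₀))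
        = u p - u w₀ + (m + 1) * q w₀ := by field_simp; ring
    have h2 := mul_le_mul_of_nonneg_left h1 hn.le
    rw [e1] at h2
    have h3 : (m + 1 : ℝ) * (q w - q w₀) ≤ 1 / 2 := by
      calc (m + 1 : ℝ) * (q w - q w₀) ≤ (m + 1) * (1 / (2 * (m + 1))) := by
            refine mul_le_mul_of_nonneg_left ?_ hn.le
            linarith [hqd.1]
        _ = 1 / 2 := by field_simp
    have h4 : K * dist w₀ w ≤ 1 / 2 := by
      calc K * dist w₀ w ≤ (K + 1) * (1 / (2 * (K + 1))) := by
            refine mul_le_mul (by linarith) (hwd.le.trans (min_le_right _ _)) dist_nonneg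
              (by linarith)
        _ = 1 / 2 := by field_simp
    linarith
  obtain ⟨ν, hν0, hν1, hν⟩ := exists_weights_sum_nonneg hAconv
    ⟨_, _, hmem (fun _ => 0), fun w => rfl⟩ hpos
  refine ⟨W, ν, fun w hw => hWT hw, hν0, hν1, fun x => ?_⟩
  have h1 := hν _ ⟨_, hmem x, fun w => rfl⟩
  set U : ℂ → ℝ := fun z => ∑ i, 2 * Real.log (max ρ ‖z - x i‖)
  have e : ∑ w : W, ν w * (U w - U p - (m + 1) * (q w - o) + 1)
      = ∑ w : W, ν w * (U w - (m + 1) * q w) + (∑ w : W, ν w) * (-U p + (m + 1) * o + 1) := by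
    rw [Finset.sum_mul, ← Finset.sum_add_distrib]
    exact Finset.sum_congr rfl fun w _ => by ring
  rw [e, hν1] at h1
  linarith

/-! ### Area measure and polar coordinates. -/

theorem volume_eq_smul_area : (volume : Measure ℂ) = NNReal.pi • area := by
  rw [area, smul_smul, mul_inv_cancel₀ NNReal.pi_ne_zero, one_smul]

theorem lintegral_volume_eq (f : ℂ → ℝ≥0∞) :
    ∫⁻ z, f z = ENNReal.ofReal Real.pi * ∫⁻ z, f z ∂area := by
  rw [volume_eq_smul_area, lintegral_smul_measure, ENNReal.smul_def, smul_eq_mul]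
  congr 1
  exact (ENNReal.ofReal_coe_nnreal (p := NNReal.pi)).symm

theorem area_closedBall (p : ℂ) (r : ℝ) :
    area (Metric.closedBall p r) = ENNReal.ofReal r ^ 2 := by
  rw [area, Measure.smul_apply, Complex.volume_closedBall, ENNReal.smul_def, smul_eq_mul, mul_comm,
    mul_assoc, ← ENNReal.coe_mul, mul_inv_cancel₀ NNReal.pi_ne_zero,
    ENNReal.coe_one, mul_one]

/-- Polar coordinates use angles in `(-π, π)`, `angleMeasure` those in `(0, 2π]`. The shift by `π`
reverses the sign of the radius. -/
theorem lintegral_angleMeasure_circleMap (f : ℂ → ℝ≥0∞) (c : ℂ) (r : ℝ) :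
    ENNReal.ofReal (2 * Real.pi) * ∫⁻ θ, f (circleMap c r θ) ∂angleMeasure
      = ∫⁻ θ in Set.Ioo (-Real.pi) Real.pi, f (circleMap c (-r) θ) := by
  have hpi := Real.pi_pos
  rw [angleMeasure, lintegral_smul_measure, smul_eq_mul, ← mul_assoc,
    ← ENNReal.ofReal_mul (by positivity), mul_inv_cancel₀ (by positivity), ENNReal.ofReal_one,
    one_mul, ← Measure.restrict_congr_set Ioo_ae_eq_Ioc, ← lintegral_indicator measurableSet_Ioo,
    ← lintegral_indicator measurableSet_Ioo, ← lintegral_add_right_eq_self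
      ((Set.Ioo 0 (2 * Real.pi)).indicator fun θ => f (circleMap c r θ)) Real.pi]
  refine lintegral_congr fun θ => ?_
  have hiff : θ + Real.pi ∈ Set.Ioo 0 (2 * Real.pi) ↔ θ ∈ Set.Ioo (-Real.pi) Real.pi := by
    simp only [Set.mem_Ioo]
    constructor <;> rintro ⟨h1, h2⟩ <;> constructor <;> linarith
  by_cases hθ : θ ∈ Set.Ioo (-Real.pi) Real.pi
  · rw [Set.indicator_of_mem hθ, Set.indicator_of_mem (hiff.2 hθ), circleMap_neg_radius]
  · rw [Set.indicator_of_notMem hθ, Set.indicator_of_notMem fun h => hθ (hiff.1 h)]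

/-- Polar coordinates about the point `c`. -/
theorem lintegral_area_eq_polar {f : ℂ → ℝ≥0∞} (hf : Measurable f) (c : ℂ) :
    ∫⁻ z, f z ∂area = 2 * ∫⁻ ρ in Set.Ioi (0 : ℝ), ENNReal.ofReal ρ
      * ∫⁻ θ, f (circleMap c ρ θ) ∂angleMeasure := by
  have hpi : ENNReal.ofReal Real.pi ≠ 0 := (ENNReal.ofReal_pos.2 Real.pi_pos).ne'
  have hcirc : Measurable fun y : ℝ × ℝ => f (circleMap c (-y.1) y.2) := by
    refine hf.comp ?_
    unfold circleMap
    fun_prop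
  have h1 : ∫⁻ z, f z = ∫⁻ z, f (c - z) := (lintegral_sub_left_eq_self f c).symm
  -- The reflection `z ↦ c - z` both recentres at `c` and produces the negative radius.
  have h2 : ∫⁻ z, f z = ∫⁻ ρ in Set.Ioi (0 : ℝ), ∫⁻ θ in Set.Ioo (-Real.pi) Real.pi,
      ENNReal.ofReal ρ * f (circleMap c (-ρ) θ) := by
    rw [h1, ← Complex.lintegral_comp_polarCoord_symm, polarCoord_target, Measure.volume_eq_prod,
      setLIntegral_prod]
    · refine lintegral_congr fun ρ => lintegral_congr fun θ => ?_
      rw [smul_eq_mul, Complex.polarCoord_symm_apply]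
      congr 2
      simp only [circleMap]
      push_cast
      rw [Complex.exp_mul_I]
      ring
    · refine AEMeasurable.mul (by fun_prop) ?_
      refine (Measurable.comp (g := fun z => f (c - z)) (hf.comp (by fun_prop)) ?_).aemeasurable
      exact Complex.measurableEquivRealProd.symm.measurable.comp
        continuous_polarCoord_symm.measurable
  have h3 : ENNReal.ofReal (2 * Real.pi) = 2 * ENNReal.ofReal Real.pi := by
    rw [ENNReal.ofReal_mul (by norm_num)]; simp
  rw [lintegral_volume_eq] at h2
  refine (ENNReal.mul_right_inj hpi ENNReal.ofReal_ne_top).1 ?_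
  rw [h2, ← mul_assoc, mul_comm _ (2 : ℝ≥0∞), ← h3,
    ← lintegral_const_mul' _ _ ENNReal.ofReal_ne_top]
  refine lintegral_congr fun ρ => ?_
  rw [lintegral_const_mul' _ _ ENNReal.ofReal_ne_top, mul_left_comm,
    lintegral_angleMeasure_circleMap]

/-! ### Transport of a particle from `p` to the coincidence set. -/

/-- Jensen for the weights `ν`, then on the circle about each `w`. Truncated logarithms increase
with the truncation radius, so weights found for `ρ` serve for every `ρ' ≥ ρ`. -/
theorem condWeight_le_sum_weights {Sig : Set ℂ} {Δ : ℝ} {h : ℂ → ℝ}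
    (hh : InnerProductSpace.HarmonicOnNhd h Sig) {β : ℝ} (hβ : 0 < β) {m : ℕ} {p : ℂ}
    (hp : p ∈ Sig) {o : ℝ} {ρ ρ' : ℝ} (hρ : 0 < ρ) (hρρ : ρ ≤ ρ') {W : Finset ℂ} {ν : W → ℝ}
    (hW : ∀ w ∈ W, Metric.closedBall w ρ' ⊆ Sig) (hν0 : ∀ w, 0 ≤ ν w) (hν1 : ∑ w, ν w = 1)
    (x : Fin m → ℂ)
    (hν : (∑ i, 2 * Real.log (max ρ ‖p - x i‖)) - (m + 1) * o - 1
          ≤ ∑ w, ν w * ((∑ i, 2 * Real.log (max ρ ‖(w : ℂ) - x i‖))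
              - (m + 1) * (Δ * ‖(w : ℂ)‖ ^ 2 + h w))) :
    condWeight (potential Sig Δ h) β p x
      ≤ ENNReal.ofReal (Real.exp (β * (1 + (m + 1) * Δ * ρ' ^ 2)
            - (m + 1) * β * (Δ * ‖p‖ ^ 2 + h p - o)))
        * ∑ w, ENNReal.ofReal (ν w)
          * ∫⁻ θ, condWeight (potential Sig Δ h) β (circleMap w ρ' θ) x ∂angleMeasure := by
  have hρ' : 0 < ρ' := hρ.trans_le hρρ
  set g : W → ℝ := fun w => (∑ j, 2 * β * Real.log (max ρ' ‖(w : ℂ) - x j‖))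
        - β * (m + 1) * (Δ * ‖(w : ℂ)‖ ^ 2 + h w + Δ * ρ' ^ 2) with hg
  have hexp : (∑ j, 2 * β * Real.log (max ρ ‖p - x j‖)) - β * (m + 1) * (Δ * ‖p‖ ^ 2 + h p)
      ≤ (β * (1 + (m + 1) * Δ * ρ' ^ 2) - (m + 1) * β * (Δ * ‖p‖ ^ 2 + h p - o))
        + ∑ w, ν w * g w := by
    have h1 : ∑ j, 2 * β * Real.log (max ρ ‖p - x j‖)
        = β * ∑ j, 2 * Real.log (max ρ ‖p - x j‖) := by
      rw [Finset.mul_sum]; exact Finset.sum_congr rfl fun j _ => by ring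
    have h2 : ∀ w : W, ν w * (β * ((∑ i, 2 * Real.log (max ρ ‖(w : ℂ) - x i‖))
        - (m + 1) * (Δ * ‖(w : ℂ)‖ ^ 2 + h w)) - β * (m + 1) * Δ * ρ' ^ 2) ≤ ν w * g w := by
      intro w
      refine mul_le_mul_of_nonneg_left ?_ (hν0 w)
      have h3 : β * (∑ i, 2 * Real.log (max ρ ‖(w : ℂ) - x i‖))
          ≤ ∑ j, 2 * β * Real.log (max ρ' ‖(w : ℂ) - x j‖) := by
        rw [Finset.mul_sum]
        refine Finset.sum_le_sum fun j _ => ?_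
        have := Real.log_le_log (lt_max_of_lt_left hρ)
          (max_le_max_right ‖(w : ℂ) - x j‖ hρρ)
        nlinarith
      simp only [hg]
      linarith
    have h4 := Finset.sum_le_sum fun w (_ : w ∈ Finset.univ) => h2 w
    have h5 : ∑ w, ν w * (β * ((∑ i, 2 * Real.log (max ρ ‖(w : ℂ) - x i‖))
        - (m + 1) * (Δ * ‖(w : ℂ)‖ ^ 2 + h w)) - β * (m + 1) * Δ * ρ' ^ 2)
        = β * (∑ w, ν w * ((∑ i, 2 * Real.log (max ρ ‖(w : ℂ) - x i‖))
              - (m + 1) * (Δ * ‖(w : ℂ)‖ ^ 2 + h w)))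
          - (∑ w, ν w) * (β * (m + 1) * Δ * ρ' ^ 2) := by
      rw [Finset.mul_sum, Finset.sum_mul, ← Finset.sum_sub_distrib]
      exact Finset.sum_congr rfl fun w _ => by ring
    rw [h5, hν1] at h4
    have h6 := mul_le_mul_of_nonneg_left hν hβ.le
    rw [h1]
    linarith
  refine (condWeight_le_prod_max _ hβ x p ρ).trans ?_
  rw [prod_max_mul_siteWeight hβ x hρ hp]
  refine (ENNReal.ofReal_le_ofReal (Real.exp_le_exp.2 hexp)).trans ?_
  rw [Real.exp_add, ENNReal.ofReal_mul (Real.exp_pos _).le]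
  refine mul_le_mul' le_rfl ?_
  have hj : Real.exp (∑ w, ν w * g w) ≤ ∑ w, ν w * Real.exp (g w) := by
    have := convexOn_exp.map_sum_le (t := Finset.univ) (w := ν) (p := g) (fun w _ => hν0 w) hν1
      (fun w _ => Set.mem_univ _)
    simpa only [smul_eq_mul] using this
  refine (ENNReal.ofReal_le_ofReal hj).trans ?_
  rw [ENNReal.ofReal_sum_of_nonneg fun w _ => mul_nonneg (hν0 w) (Real.exp_pos _).le]
  refine Finset.sum_le_sum fun w _ => ?_
  rw [ENNReal.ofReal_mul (hν0 w)]
  exact mul_le_mul' le_rfl (condWeight_isotropic_average hh hβ x hρ' (hW w w.2))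

theorem lintegral_Ioc_ofReal_id {r : ℝ} (hr : 0 < r) :
    ∫⁻ ρ in Set.Ioc (r / 2) r, ENNReal.ofReal ρ = ENNReal.ofReal (3 * r ^ 2 / 8) := by
  rw [← ofReal_integral_eq_lintegral_ofReal, ← intervalIntegral.integral_of_le (by linarith),
    integral_id]
  · congr 1; ring
  · exact (intervalIntegrable_iff_integrableOn_Ioc_of_le (by linarith)).1
      intervalIntegral.intervalIntegrable_id
  · refine (ae_restrict_iff' measurableSet_Ioc).2 (ae_of_all _ fun ρ hρ => ?_)
    have : 0 < ρ := by linarith [hρ.1]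
    exact this.le

/-- Integrating the circle bound over radii in `(r / 2, r]` with density `ρ` turns circle means into
disc integrals, that is, into expected counts. A single `ν`, chosen for `r / 2`, works for all these
radii. -/
theorem marginalWeight_le_sum_weights {Sig : Set ℂ} (hS : IsClosed Sig) {Δ : ℝ} (hΔ : 0 ≤ Δ)
    {h : ℂ → ℝ} (hh : InnerProductSpace.HarmonicOnNhd h Sig) {β : ℝ} (hβ : 0 < β) {m : ℕ}
    {p : ℂ} (hp : p ∈ Sig) {o r : ℝ} (hr : 0 < r) {W : Finset ℂ} {ν : W → ℝ}
    (hW : ∀ w ∈ W, Metric.closedBall w r ⊆ Sig) (hν0 : ∀ w, 0 ≤ ν w) (hν1 : ∑ w, ν w = 1)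
    (hν : ∀ x : Fin m → ℂ, (∑ i, 2 * Real.log (max (r / 2) ‖p - x i‖)) - (m + 1) * o - 1
          ≤ ∑ w, ν w * ((∑ i, 2 * Real.log (max (r / 2) ‖(w : ℂ) - x i‖))
              - (m + 1) * (Δ * ‖(w : ℂ)‖ ^ 2 + h w))) :
    ENNReal.ofReal (3 * r ^ 2 / 8) * marginalWeight (potential Sig Δ h) β m p
      ≤ ENNReal.ofReal (Real.exp (β * (1 + (m + 1) * Δ * r ^ 2)
            - (m + 1) * β * (Δ * ‖p‖ ^ 2 + h p - o)))
        * ∑ w, ENNReal.ofReal (ν w) * (2⁻¹ * ∫⁻ q in Metric.closedBall (w : ℂ) r,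
            marginalWeight (potential Sig Δ h) β m q ∂area) := by
  have hc := continuousOn_of_harmonicOnNhd hh
  set Q := potential Sig Δ h
  set κ := ENNReal.ofReal (Real.exp (β * (1 + (m + 1) * Δ * r ^ 2)
            - (m + 1) * β * (Δ * ‖p‖ ^ 2 + h p - o)))
  have hM : Measurable (marginalWeight Q β m) := measurable_marginalWeight hS hc hβ m
  have hMc : ∀ w : ℂ, Measurable fun ρ : ℝ =>
      ∫⁻ θ, marginalWeight Q β m (circleMap w ρ θ) ∂angleMeasure := fun w => by
    have : Measurable fun y : ℝ × ℝ => marginalWeight Q β m (circleMap w y.1 y.2) := by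
      refine hM.comp ?_
      unfold circleMap
      fun_prop
    exact this.lintegral_prod_right'
  have hcirc : ∀ ρ ∈ Set.Ioc (r / 2) r, marginalWeight Q β m p
      ≤ κ * ∑ w : W, ENNReal.ofReal (ν w)
        * ∫⁻ θ, marginalWeight Q β m (circleMap w ρ θ) ∂angleMeasure := by
    intro ρ hρ
    have hρ0 : 0 < ρ := by linarith [hρ.1]
    have hcm : ∀ w : W, Measurable fun x : Fin m → ℂ =>
        (∫⁻ θ, condWeight Q β (circleMap w ρ θ) x ∂angleMeasure) * restWeight Q β x := fun w => by
      have : Measurable fun y : (Fin m → ℂ) × ℝ => condWeight Q β (circleMap w ρ y.2) y.1 :=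
        measurable_condWeight hS hc hβ ((measurable_circleMap _ _).comp measurable_snd)
          measurable_fst
      exact this.lintegral_prod_right'.mul (measurable_restWeight hS hc hβ measurable_id)
    have hcm' : ∀ w ∈ (Finset.univ : Finset W), Measurable fun x : Fin m → ℂ =>
        ENNReal.ofReal (ν w) * ((∫⁻ θ, condWeight Q β (circleMap w ρ θ) x ∂angleMeasure)
          * restWeight Q β x) := fun w _ => (hcm w).const_mul _
    calc marginalWeight Q β m p
        ≤ ∫⁻ x, κ * ∑ w : W, ENNReal.ofReal (ν w)
          * ((∫⁻ θ, condWeight Q β (circleMap w ρ θ) x ∂angleMeasure) * restWeight Q β x)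
            ∂(areaPi m) := by
          refine lintegral_mono fun x => ?_
          have h1 := condWeight_le_sum_weights hh hβ hp (half_pos hr) hρ.1.le
            (fun w hw => (Metric.closedBall_subset_closedBall hρ.2).trans (hW w hw)) hν0 hν1 x
            (hν x)
          refine (mul_le_mul' h1 le_rfl).trans ?_
          rw [mul_assoc, Finset.sum_mul]
          simp only [mul_assoc]
          refine mul_le_mul' (ENNReal.ofReal_le_ofReal (Real.exp_le_exp.2 ?_)) le_rfl
          have h2 : ρ ^ 2 ≤ r ^ 2 := pow_le_pow_left₀ hρ0.le hρ.2 2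
          have h3 : (m + 1) * Δ * ρ ^ 2 ≤ (m + 1) * Δ * r ^ 2 := by gcongr
          nlinarith [mul_le_mul_of_nonneg_left h3 hβ.le]
      _ = _ := by
          rw [lintegral_const_mul' _ _ ENNReal.ofReal_ne_top, lintegral_finsetSum _ hcm']
          congr 1
          refine Finset.sum_congr rfl fun w _ => ?_
          rw [lintegral_const_mul' _ _ ENNReal.ofReal_ne_top,
            lintegral_circle_marginalWeight hS hc hβ]
  have hdisc : ∀ w : W, ∫⁻ ρ in Set.Ioc (r / 2) r, ENNReal.ofReal ρ
      * ∫⁻ θ, marginalWeight Q β m (circleMap w ρ θ) ∂angleMeasure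
      ≤ 2⁻¹ * ∫⁻ q in Metric.closedBall (w : ℂ) r, marginalWeight Q β m q ∂area := by
    intro w
    have hD : MeasurableSet (Metric.closedBall (w : ℂ) r) :=
      Metric.isClosed_closedBall.measurableSet
    rw [← lintegral_indicator hD, lintegral_area_eq_polar (hM.indicator hD) w, ← mul_assoc,
      ENNReal.inv_mul_cancel two_ne_zero ENNReal.ofNat_ne_top, one_mul]
    have hsub : Set.Ioc (r / 2) r ⊆ Set.Ioi 0 := fun ρ hρ => by
      have : 0 < ρ := by linarith [hρ.1]
      exact this
    refine le_trans (le_of_eq ?_) (lintegral_mono_set hsub)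
    refine setLIntegral_congr_fun measurableSet_Ioc fun ρ hρ => ?_
    congr 1
    refine lintegral_congr fun θ => ?_
    rw [Set.indicator_of_mem]
    exact Metric.closedBall_subset_closedBall hρ.2 (circleMap_mem_closedBall _ (hsub hρ).le θ)
  have hsm : ∀ w ∈ (Finset.univ : Finset W), Measurable fun ρ : ℝ => ENNReal.ofReal (ν w)
      * (ENNReal.ofReal ρ * ∫⁻ θ, marginalWeight Q β m (circleMap w ρ θ) ∂angleMeasure) :=
    fun w _ => (ENNReal.measurable_ofReal.mul (hMc w)).const_mul _
  calc ENNReal.ofReal (3 * r ^ 2 / 8) * marginalWeight Q β m p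
      = ∫⁻ ρ in Set.Ioc (r / 2) r, ENNReal.ofReal ρ * marginalWeight Q β m p := by
        rw [lintegral_mul_const _ ENNReal.measurable_ofReal, lintegral_Ioc_ofReal_id hr]
    _ ≤ ∫⁻ ρ in Set.Ioc (r / 2) r, κ * ∑ w : W, ENNReal.ofReal (ν w) * (ENNReal.ofReal ρ
          * ∫⁻ θ, marginalWeight Q β m (circleMap w ρ θ) ∂angleMeasure) := by
        refine setLIntegral_mono' measurableSet_Ioc fun ρ hρ => ?_
        refine (mul_le_mul' le_rfl (hcirc ρ hρ)).trans (le_of_eq ?_)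
        rw [mul_left_comm, Finset.mul_sum]
        congr 1
        exact Finset.sum_congr rfl fun w _ => mul_left_comm _ _ _
    _ = κ * ∑ w : W, ENNReal.ofReal (ν w) * ∫⁻ ρ in Set.Ioc (r / 2) r, (ENNReal.ofReal ρ
          * ∫⁻ θ, marginalWeight Q β m (circleMap w ρ θ) ∂angleMeasure) := by
        rw [lintegral_const_mul' _ _ ENNReal.ofReal_ne_top, lintegral_finsetSum _ hsm]
        congr 1
        exact Finset.sum_congr rfl fun w _ => lintegral_const_mul' _ _ ENNReal.ofReal_ne_top
    _ ≤ _ := by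
        gcongr with w _
        exact hdisc w

/-! ### Continuity of the one-particle density and its relation to `onePoint`. -/

theorem exists_siteWeight_le {Sig : Set ℂ} (hS : IsCompact Sig) {Δ : ℝ} {h : ℂ → ℝ}
    (hh : ContinuousOn h Sig) {b : ℝ} (hb : 0 < b) :
    ∃ C : ℝ≥0∞, C ≠ ⊤ ∧ ∀ z, siteWeight (potential Sig Δ h) b z ≤ C := by
  have hc : ContinuousOn (fun z => Real.exp (-(b * (Δ * ‖z‖ ^ 2 + h z)))) Sig := by fun_prop
  obtain ⟨C, hC⟩ := hS.bddAbove_image hc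
  refine ⟨ENNReal.ofReal C, ENNReal.ofReal_ne_top, fun z => ?_⟩
  rw [siteWeight_potential hb]
  by_cases hz : z ∈ Sig
  · rw [Set.indicator_of_mem hz]
    exact ENNReal.ofReal_le_ofReal (hC (Set.mem_image_of_mem _ hz))
  · rw [Set.indicator_of_notMem hz]
    exact zero_le

theorem exists_edist_le {Sig : Set ℂ} (hS : IsCompact Sig) :
    ∃ d : ℝ≥0∞, d ≠ ⊤ ∧ 1 ≤ d ∧ ∀ z ∈ Sig, ∀ w ∈ Sig, edist z w ≤ d :=
  ⟨max 1 (Metric.ediam Sig), max_ne_top ENNReal.one_ne_top hS.isBounded.ediam_ne_top,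
    le_max_left _ _, fun _ hz _ hw => (Metric.edist_le_ediam_of_mem hz hw).trans (le_max_right _ _)⟩

theorem siteWeight_eq_zero {Sig : Set ℂ} {Δ : ℝ} {h : ℂ → ℝ} {b : ℝ} (hb : 0 < b) {z : ℂ}
    (hz : z ∉ Sig) : siteWeight (potential Sig Δ h) b z = 0 := by
  rw [siteWeight_potential hb, Set.indicator_of_notMem hz]

theorem restWeight_eq_zero {Sig : Set ℂ} {Δ : ℝ} {h : ℂ → ℝ} {β : ℝ} (hβ : 0 < β) {m : ℕ}
    {x : Fin m → ℂ} {i : Fin m} (hi : x i ∉ Sig) :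
    restWeight (potential Sig Δ h) β x = 0 := by
  have hb : 0 < β * ((m : ℝ) + 1) := by positivity
  exact mul_eq_zero_of_right _
    (Finset.prod_eq_zero (Finset.mem_univ i) (siteWeight_eq_zero hb hi))

theorem exists_restWeight_le {Sig : Set ℂ} (hS : IsCompact Sig) {Δ : ℝ} {h : ℂ → ℝ}
    (hh : ContinuousOn h Sig) {β : ℝ} (hβ : 0 < β) (m : ℕ) :
    ∃ C : ℝ≥0∞, C ≠ ⊤ ∧ ∀ x : Fin m → ℂ, restWeight (potential Sig Δ h) β x ≤ C := by
  obtain ⟨c, hc, hcle⟩ := exists_siteWeight_le (Δ := Δ) hS hh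
    (show 0 < β * ((m : ℝ) + 1) by positivity)
  obtain ⟨d, hd, hd1, hdle⟩ := exists_edist_le hS
  refine ⟨(∏ _i : Fin m, ∏ _j : Fin m, d ^ β) * ∏ _i : Fin m, c, ?_, fun x => ?_⟩
  · refine ENNReal.mul_ne_top (ENNReal.prod_ne_top fun i _ => ENNReal.prod_ne_top fun j _ => ?_)
      (ENNReal.prod_ne_top fun i _ => hc)
    exact ENNReal.rpow_ne_top_of_nonneg hβ.le hd
  · by_cases hx : ∀ i, x i ∈ Sig
    · rw [restWeight]
      gcongr with i _ j _ i _
      · split_ifs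
        · exact ENNReal.rpow_le_rpow (hdle _ (hx i) _ (hx j)) hβ.le
        · exact ENNReal.one_le_rpow hd1 hβ
      · exact hcle _
    · push Not at hx
      obtain ⟨i, hi⟩ := hx
      rw [restWeight_eq_zero hβ hi]
      exact zero_le

theorem lintegral_restWeight_ne_top {Sig : Set ℂ} (hS : IsCompact Sig) {Δ : ℝ} {h : ℂ → ℝ}
    (hh : ContinuousOn h Sig) {β : ℝ} (hβ : 0 < β) (m : ℕ) :
    ∫⁻ x : Fin m → ℂ, restWeight (potential Sig Δ h) β x ∂(areaPi m) ≠ ⊤ := by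
  obtain ⟨C, hC, hle⟩ := exists_restWeight_le (Δ := Δ) hS hh hβ m
  have hSm : MeasurableSet (Set.univ.pi fun _ : Fin m => Sig) :=
    MeasurableSet.univ_pi fun _ => hS.isClosed.measurableSet
  refine ne_top_of_le_ne_top (b := ∫⁻ x, (Set.univ.pi fun _ : Fin m => Sig).indicator
    (fun _ => C) x ∂(areaPi m)) ?_ (lintegral_mono fun x => ?_)
  · rw [lintegral_indicator hSm, setLIntegral_const, areaPi, Measure.pi_pi]
    refine ENNReal.mul_ne_top hC (ENNReal.prod_ne_top fun i _ => ?_)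
    rw [area, Measure.smul_apply, ENNReal.smul_def, smul_eq_mul]
    exact ENNReal.mul_ne_top ENNReal.coe_ne_top hS.measure_ne_top
  · by_cases hx : x ∈ Set.univ.pi fun _ : Fin m => Sig
    · rw [Set.indicator_of_mem hx]; exact hle x
    · simp only [Set.mem_univ_pi, not_forall] at hx
      obtain ⟨i, hi⟩ := hx
      rw [restWeight_eq_zero hβ hi]
      exact zero_le

theorem continuousOn_condWeight {Sig : Set ℂ} {Δ : ℝ} {h : ℂ → ℝ} (hh : ContinuousOn h Sig)
    {β : ℝ} (hβ : 0 < β) {m : ℕ} (x : Fin m → ℂ) :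
    ContinuousOn (fun q => condWeight (potential Sig Δ h) β q x) Sig := by
  have hreal : ContinuousOn (fun q => ENNReal.ofReal ((∏ j, ‖q - x j‖ ^ (2 * β))
      * Real.exp (-(β * (m + 1) * (Δ * ‖q‖ ^ 2 + h q))))) Sig := by
    refine ENNReal.continuous_ofReal.comp_continuousOn (ContinuousOn.mul ?_ (by fun_prop))
    refine Continuous.continuousOn (continuous_finsetProd _ fun j _ => ?_)
    exact Continuous.rpow_const (by fun_prop) fun _ => Or.inr (by positivity)
  refine hreal.congr fun q hq => ?_
  simp only [condWeight]
  rw [siteWeight_potential (by positivity), Set.indicator_of_mem hq,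
    ENNReal.ofReal_mul (Finset.prod_nonneg fun j _ => by positivity),
    ENNReal.ofReal_prod_of_nonneg fun j _ => by positivity]
  congr 1
  refine Finset.prod_congr rfl fun j _ => ?_
  rw [edist_eq_enorm_sub, ← ofReal_norm, ENNReal.ofReal_rpow_of_nonneg (norm_nonneg _)
    (by positivity)]

/-- Dominated convergence with a multiple of `restWeight`. Only continuity relative to `Sig` can be
expected, as the density may jump at the boundary. -/
theorem continuousOn_marginalWeight {Sig : Set ℂ} (hS : IsCompact Sig) {Δ : ℝ} {h : ℂ → ℝ}
    (hh : ContinuousOn h Sig) {β : ℝ} (hβ : 0 < β) (m : ℕ) :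
    ContinuousOn (marginalWeight (potential Sig Δ h) β m) Sig := by
  intro p hp
  obtain ⟨c, hc, hcle⟩ := exists_siteWeight_le (Δ := Δ) hS hh
    (show 0 < β * ((m : ℝ) + 1) by positivity)
  obtain ⟨d, hd, hd1, hdle⟩ := exists_edist_le hS
  obtain ⟨C, hC, hCle⟩ := exists_restWeight_le (Δ := Δ) hS hh hβ m
  set k : ℝ≥0∞ := (∏ _j : Fin m, d ^ (2 * β)) * c with hk
  have hk' : k ≠ ⊤ := ENNReal.mul_ne_top (ENNReal.prod_ne_top fun j _ =>
    ENNReal.rpow_ne_top_of_nonneg (by positivity) hd) hc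
  refine tendsto_lintegral_filter_of_dominated_convergence
    (fun x => k * restWeight (potential Sig Δ h) β x) ?_ ?_ ?_ ?_
  · exact Eventually.of_forall fun q =>
      measurable_cond_mul_rest hS.isClosed hh hβ measurable_const measurable_id
  · filter_upwards [self_mem_nhdsWithin] with q hq
    refine ae_of_all _ fun x => ?_
    by_cases hx : ∀ i, x i ∈ Sig
    · refine mul_le_mul' ?_ le_rfl
      rw [condWeight, hk]
      gcongr with j _
      · exact hdle _ hq _ (hx j)
      · exact hcle _
    · push Not at hx
      obtain ⟨i, hi⟩ := hx
      rw [restWeight_eq_zero hβ hi, mul_zero]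
      exact zero_le
  · rw [lintegral_const_mul' _ _ hk']
    exact ENNReal.mul_ne_top hk' (lintegral_restWeight_ne_top hS hh hβ m)
  · refine ae_of_all _ fun x => ?_
    exact ENNReal.Tendsto.mul_const (continuousOn_condWeight hh hβ x p hp)
      (Or.inr (ne_top_of_le_ne_top hC (hCle x)))

theorem marginalWeight_eq_zero {Sig : Set ℂ} {Δ : ℝ} {h : ℂ → ℝ} {β : ℝ} (hβ : 0 < β) (m : ℕ)
    {q : ℂ} (hq : q ∉ Sig) : marginalWeight (potential Sig Δ h) β m q = 0 := by
  have hb : 0 < β * ((m : ℝ) + 1) := by positivity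
  simp [marginalWeight, condWeight, siteWeight_eq_zero hb hq]

/-- Covers sets `Sig` of zero area: the infinite factor `Z⁻¹` multiplies a null measure. -/
theorem gibbs_eq_zero {Q : ℂ → EReal} {β : ℝ} {n : ℕ} (hm : Measurable (boltzmann Q β n))
    (hZ : partitionFunction Q β n = 0) : gibbs Q β n = 0 := by
  rw [partitionFunction, lintegral_eq_zero_iff hm] at hZ
  rw [gibbs, withDensity_congr_ae hZ]
  simp

/-- The normalized one-particle density. -/
noncomputable def oneDensity (Q : ℂ → EReal) (β : ℝ) (m : ℕ) (q : ℂ) : ℝ≥0∞ :=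
  (partitionFunction Q β (m + 1))⁻¹ * ((m + 1) * marginalWeight Q β m q)

theorem expectedCount_eq_setLIntegral {Sig : Set ℂ} (hS : IsClosed Sig) {Δ : ℝ} {h : ℂ → ℝ}
    (hh : ContinuousOn h Sig) {β : ℝ} (hβ : 0 < β) (m : ℕ) (p : ℂ) (r : ℝ) :
    expectedCount (potential Sig Δ h) β (m + 1) p r
      = ∫⁻ q in Metric.closedBall p r, oneDensity (potential Sig Δ h) β m q ∂area := by
  have hM := measurable_marginalWeight (Δ := Δ) hS hh hβ m
  unfold oneDensity
  rw [expectedCount_eq hS hh hβ, lintegral_const_mul _ (hM.const_mul _),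
    lintegral_const_mul _ hM]

/-- Off `Sig` the density vanishes, so a limit within `Sig` suffices; a disc of radius `ε` has area
exactly `ε ^ 2`. -/
theorem onePoint_le_of_tendsto {Sig : Set ℂ} (hS : IsClosed Sig) {Δ : ℝ} {h : ℂ → ℝ}
    (hh : ContinuousOn h Sig) {β : ℝ} (hβ : 0 < β) (m : ℕ) {p : ℂ} {a : ℝ≥0∞}
    (ha : Tendsto (oneDensity (potential Sig Δ h) β m) (𝓝[Sig] p) (𝓝 a)) :
    onePoint (potential Sig Δ h) β (m + 1) p ≤ a := by
  refine le_of_forall_gt_imp_ge_of_dense fun b hb => ?_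
  have hev := ha.eventually (Iic_mem_nhds hb)
  rw [eventually_nhdsWithin_iff, Metric.eventually_nhds_iff] at hev
  obtain ⟨δ, hδ, hle⟩ := hev
  refine limsup_le_of_le (by isBoundedDefault) ?_
  filter_upwards [Ioo_mem_nhdsGT hδ] with ε hε
  refine ENNReal.div_le_of_le_mul ?_
  calc ∫⁻ z, particleCount p ε z ∂(gibbs (potential Sig Δ h) β (m + 1))
      = ∫⁻ q in Metric.closedBall p ε, oneDensity (potential Sig Δ h) β m q ∂area :=
        expectedCount_eq_setLIntegral hS hh hβ m p ε
    _ ≤ ∫⁻ _ in Metric.closedBall p ε, b ∂area := by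
        refine setLIntegral_mono' Metric.isClosed_closedBall.measurableSet fun q hq => ?_
        by_cases hqS : q ∈ Sig
        · exact hle (lt_of_le_of_lt hq hε.2) hqS
        · rw [oneDensity, marginalWeight_eq_zero hβ m hqS, mul_zero, mul_zero]
          exact zero_le
    _ = b * ENNReal.ofReal (ε ^ 2) := by
        rw [setLIntegral_const, area_closedBall, ENNReal.ofReal_pow hε.1.le]

theorem onePoint_eq_zero {Sig : Set ℂ} (hS : IsClosed Sig) {Δ : ℝ} {h : ℂ → ℝ}
    (hh : ContinuousOn h Sig) {β : ℝ} (hβ : 0 < β) (m : ℕ) {p : ℂ} (hp : p ∉ Sig) :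
    onePoint (potential Sig Δ h) β (m + 1) p = 0 := by
  refine le_antisymm (onePoint_le_of_tendsto hS hh hβ m ?_) zero_le
  have : 𝓝[Sig] p = ⊥ := by
    rwa [← not_neBot, ← mem_closure_iff_nhdsWithin_neBot, hS.closure_eq]
  rw [this]
  exact tendsto_bot

theorem onePoint_le_oneDensity {Sig : Set ℂ} (hS : IsCompact Sig) {Δ : ℝ} {h : ℂ → ℝ}
    (hh : ContinuousOn h Sig) {β : ℝ} (hβ : 0 < β) (m : ℕ) {p : ℂ} (hp : p ∈ Sig) :
    onePoint (potential Sig Δ h) β (m + 1) p ≤ oneDensity (potential Sig Δ h) β m p := by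
  rcases eq_or_ne (partitionFunction (potential Sig Δ h) β (m + 1)) 0 with hZ | hZ
  · rw [onePoint, gibbs_eq_zero (measurable_boltzmann hS.isClosed hh hβ m) hZ]
    simp
  · refine onePoint_le_of_tendsto hS.isClosed hh hβ m ?_
    refine ENNReal.Tendsto.const_mul (ENNReal.Tendsto.const_mul
      (continuousOn_marginalWeight hS hh hβ m p hp) (Or.inr ?_)) (Or.inr (ENNReal.inv_ne_top.2 hZ))
    exact ENNReal.add_ne_top.2 ⟨ENNReal.natCast_ne_top m, ENNReal.one_ne_top⟩

/-! ### Assembly of the bound and bookkeeping of constants. -/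

/-- The one-point function is controlled, through the obstacle function, by the expected numbers of
particles in microscopic discs centered at points of the coincidence set. -/
theorem onePoint_le_of_expectedCount_le {Sig : Set ℂ} (hS : IsCompact Sig) {Δ : ℝ} (hΔ : 0 ≤ Δ)
    {h : ℂ → ℝ} (hh : InnerProductSpace.HarmonicOnNhd h Sig) {β : ℝ} (hβ : 0 < β) (m : ℕ) {p : ℂ}
    (hp : p ∈ Sig) {o r : ℝ} (ho : obstacle (potential Sig Δ h) p = o) (hr : 0 < r)
    (hrn : (m + 1) * Δ * r ^ 2 ≤ 1) {M : ℝ} (hM0 : 0 ≤ M)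
    (hM : ∀ w ∈ coincidenceSet (potential Sig Δ h), Metric.closedBall w r ⊆ Sig ∧
      expectedCount (potential Sig Δ h) β (m + 1) w r ≤ ENNReal.ofReal M) :
    onePoint (potential Sig Δ h) β (m + 1) p
      ≤ ENNReal.ofReal (4 / (3 * r ^ 2) * M * Real.exp (2 * β)
          * Real.exp (-((m + 1) * β * (Δ * ‖p‖ ^ 2 + h p - o)))) := by
  have hc := continuousOn_of_harmonicOnNhd hh
  refine (onePoint_le_oneDensity hS hc hβ m hp).trans ?_
  obtain ⟨W, ν, hW, hν0, hν1, hν⟩ := exists_weights_coincidenceSet hS hc hp ho m (half_pos hr)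
  have hmain := marginalWeight_le_sum_weights hS.isClosed hΔ hh hβ hp hr
    (fun w hw => (hM w (hW w hw).2).1) hν0 hν1 hν
  set Q := potential Sig Δ h
  set Zi := (partitionFunction Q β (m + 1))⁻¹ with hZi
  set κ := ENNReal.ofReal (Real.exp (β * (1 + (m + 1) * Δ * r ^ 2)
            - (m + 1) * β * (Δ * ‖p‖ ^ 2 + h p - o)))
  have hr8 : 0 < 3 * r ^ 2 / 8 := by positivity
  have h1 : ENNReal.ofReal (3 * r ^ 2 / 8) * oneDensity Q β m p
      ≤ κ * (2⁻¹ * ENNReal.ofReal M) := by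
    calc ENNReal.ofReal (3 * r ^ 2 / 8) * oneDensity Q β m p
        = Zi * ((m + 1) * (ENNReal.ofReal (3 * r ^ 2 / 8) * marginalWeight Q β m p)) := by
          rw [oneDensity]; ring
      _ ≤ Zi * ((m + 1) * (κ * ∑ w, ENNReal.ofReal (ν w)
            * (2⁻¹ * ∫⁻ q in Metric.closedBall (w : ℂ) r, marginalWeight Q β m q ∂area))) := by
          gcongr
      _ = κ * ∑ w : W, ENNReal.ofReal (ν w) * (2⁻¹ * expectedCount Q β (m + 1) w r) := by
          rw [mul_left_comm _ κ, mul_left_comm _ κ, Finset.mul_sum, Finset.mul_sum]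
          congr 1
          refine Finset.sum_congr rfl fun w _ => ?_
          rw [expectedCount_eq hS.isClosed hc hβ]
          ring
      _ ≤ κ * ∑ w : W, ENNReal.ofReal (ν w) * (2⁻¹ * ENNReal.ofReal M) := by
          gcongr with w _
          exact (hM w (hW w w.2).2).2
      _ = κ * (2⁻¹ * ENNReal.ofReal M) := by
          rw [← Finset.sum_mul, ← ENNReal.ofReal_sum_of_nonneg fun w _ => hν0 w, hν1,
            ENNReal.ofReal_one, one_mul]
  have h2 : (2⁻¹ : ℝ≥0∞) = ENNReal.ofReal (1 / 2) := by
    rw [one_div, ENNReal.ofReal_inv_of_pos two_pos]; simp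
  rw [h2, ← ENNReal.ofReal_mul (by norm_num), ← ENNReal.ofReal_mul (Real.exp_pos _).le] at h1
  have h3 : oneDensity Q β m p ≤ ENNReal.ofReal (Real.exp (β * (1 + (m + 1) * Δ * r ^ 2)
      - (m + 1) * β * (Δ * ‖p‖ ^ 2 + h p - o)) * (1 / 2 * M)) / ENNReal.ofReal (3 * r ^ 2 / 8) := by
    rw [ENNReal.le_div_iff_mul_le (Or.inl (ENNReal.ofReal_pos.2 hr8).ne')
      (Or.inl ENNReal.ofReal_ne_top), mul_comm]
    exact h1
  refine h3.trans ?_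
  rw [← ENNReal.ofReal_div_of_pos hr8]
  refine ENNReal.ofReal_le_ofReal ?_
  -- One `β` in `2 * β` pays for the loss `1` in the minimax, the other for the move to a circle of
  -- radius at most `r`.
  have h4 : Real.exp (β * (1 + (m + 1) * Δ * r ^ 2) - (m + 1) * β * (Δ * ‖p‖ ^ 2 + h p - o))
      ≤ Real.exp (2 * β) * Real.exp (-((m + 1) * β * (Δ * ‖p‖ ^ 2 + h p - o))) := by
    rw [← Real.exp_add]
    refine Real.exp_le_exp.2 ?_
    nlinarith [mul_le_mul_of_nonneg_left hrn hβ.le]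
  calc _ ≤ (Real.exp (2 * β) * Real.exp (-((m + 1) * β * (Δ * ‖p‖ ^ 2 + h p - o))))
          * (1 / 2 * M) / (3 * r ^ 2 / 8) := by gcongr
    _ = _ := by field_simp; ring

theorem add_one_sq_le_four_mul_two_pow (j : ℕ) : (j + 1) ^ 2 ≤ 4 * 2 ^ j := by
  induction j with
  | zero => norm_num
  | succ j ih =>
    rcases Nat.lt_or_ge j 2 with hj | hj
    · interval_cases j <;> norm_num
    · rw [pow_succ 2 j]
      nlinarith

/-- The expected number of particles in a microscopic disc at a macroscopic distance from the
complement of `Sig` is bounded. -/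
theorem expectedCount_le_const {Sig : Set ℂ} (hS : IsClosed Sig) {Δ₀ Δ : ℝ} (hΔ₀ : 0 < Δ₀)
    (hΔ : Δ₀ ≤ Δ) {h : ℂ → ℝ} (hh : InnerProductSpace.HarmonicOnNhd h Sig) {β : ℝ} (hβ : 0 < β)
    (m : ℕ) {η r : ℝ} (hη : 0 < η) (hr : 0 < r) (hrn : (m + 1) * Δ * (4 * r) ^ 2 = 1) {w : ℂ}
    (hw : Metric.closedBall w η ⊆ Sig) :
    expectedCount (potential Sig Δ h) β (m + 1) w r
      ≤ ENNReal.ofReal (2 / β + 4 + 16 / (η ^ 2 * Δ₀)) := by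
  -- As many steps as fit into the distance `η`, about `η √(n Δ) / 2`. Then `2 ^ (-j)` beats the
  -- initial bound `n`, since `n Δ` is of order at most `(j + 1)² / η²`.
  set j := ⌊η / (8 * r)⌋₊
  have h8 : 0 < 8 * r := by positivity
  have hj : 8 * r * j ≤ η := by
    have := Nat.floor_le (div_nonneg hη.le h8.le)
    rwa [le_div_iff₀ h8, mul_comm] at this
  have hj2 : η < 8 * r * (j + 1) := by
    have := Nat.lt_floor_add_one (η / (8 * r))
    rwa [div_lt_iff₀ h8, mul_comm] at this
  have hmain := expectedCount_le hS hh hβ m hr hrn.le (Nat.le_ceil (1 / β)) j w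
    ((Metric.closedBall_subset_closedBall hj).trans hw)
  refine hmain.trans ?_
  have hs : (⌈1 / β⌉₊ : ℝ) ≤ 1 / β + 1 := (Nat.ceil_lt_add_one (by positivity)).le
  have hsmall : (1 / 2 : ℝ) ^ j * (m + 1) ≤ 16 / (η ^ 2 * Δ₀) := by
    have h1 : η ^ 2 ≤ (8 * r * (j + 1)) ^ 2 := pow_le_pow_left₀ hη.le hj2.le 2
    have h2 : ((j : ℝ) + 1) ^ 2 ≤ 4 * 2 ^ j := by exact_mod_cast add_one_sq_le_four_mul_two_pow j
    have h3 : η ^ 2 * Δ₀ * (m + 1) ≤ 16 * 2 ^ j := by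
      calc η ^ 2 * Δ₀ * (m + 1) ≤ (8 * r * (j + 1)) ^ 2 * Δ * (m + 1) := by gcongr
        _ = 4 * (j + 1) ^ 2 * ((m + 1) * Δ * (4 * r) ^ 2) := by ring
        _ ≤ 4 * (4 * 2 ^ j) * 1 := by rw [hrn]; gcongr
        _ = _ := by ring
    rw [le_div_iff₀ (by positivity), one_div, inv_pow, mul_assoc, inv_mul_le_iff₀ (by positivity)]
    linarith
  have e : 2 * ((⌈1 / β⌉₊ : ℝ≥0∞) + 1) + 2⁻¹ ^ j * ((m + 1 : ℕ) : ℝ≥0∞)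
      = ENNReal.ofReal (2 * ((⌈1 / β⌉₊ : ℝ) + 1) + (1 / 2) ^ j * (m + 1)) := by
    rw [ENNReal.ofReal_add (by positivity) (by positivity), ENNReal.ofReal_mul (by norm_num),
      ENNReal.ofReal_mul (by positivity), ENNReal.ofReal_pow (by norm_num),
      ENNReal.ofReal_add (by positivity) (by norm_num), ENNReal.ofReal_natCast,
      ENNReal.ofReal_add (by positivity) (by norm_num), ENNReal.ofReal_natCast, one_div 2,
      ENNReal.ofReal_inv_of_pos two_pos]
    simp
  rw [e]
  refine ENNReal.ofReal_le_ofReal ?_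
  have : 2 / β = 2 * (1 / β) := by ring
  linarith

theorem closedBall_subset_of_two_mul_le_dist {Sig : Set ℂ} {η : ℝ} (hη : 0 < η) {z : ℂ}
    (hz : ∀ w ∉ Sig, 2 * η ≤ dist z w) : Metric.closedBall z η ⊆ Sig := by
  intro w hw
  by_contra hwS
  have := hz w hwS
  rw [Metric.mem_closedBall, dist_comm] at hw
  linarith

theorem expectedCount_mono (Q : ℂ → EReal) (β : ℝ) (n : ℕ) (p : ℂ) {r r' : ℝ} (hr : r ≤ r') :
    expectedCount Q β n p r ≤ expectedCount Q β n p r' := by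
  refine lintegral_mono fun z => Finset.sum_le_sum fun i _ => ?_
  exact Set.indicator_le_indicator_of_subset (Metric.closedBall_subset_closedBall hr)
    (fun _ => zero_le) _

/-- Large `β` is absorbed by the exponential, small `β` by `β⁻²`; the two regimes combine through `β
+ 1 / β ≥ 1`. -/
theorem mul_one_add_inv_le_exp_mul {c β : ℝ} (hc : 0 ≤ c) (hβ : 0 < β) :
    c * (1 + 1 / β) ≤ Real.exp (2 * c * β) * (1 + β ^ (-2 : ℤ)) := by
  have h1 : 2 * c * β + 1 ≤ Real.exp (2 * c * β) := Real.add_one_le_exp _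
  have h2 : β ^ (-2 : ℤ) = (1 / β) ^ 2 := by
    rw [zpow_neg, one_div, inv_pow]; norm_cast
  rw [h2]
  set t := 1 / β with ht
  have ht0 : 0 < t := by positivity
  have hbt : β * t = 1 := by rw [ht]; field_simp
  calc c * (1 + t) ≤ (2 * c * β + 1) * (1 + t ^ 2) := by
        have e : (2 * c * β + 1) * (1 + t ^ 2)
            = 2 * c * β + 2 * c * (β * t) * t + 1 + t ^ 2 := by ring
        rw [e, hbt]
        have h3 : 1 ≤ β + t := by nlinarith [sq_nonneg (β - t)]
        nlinarith [mul_nonneg hc (sub_nonneg.2 h3), mul_nonneg hc ht0.le, mul_nonneg hc hβ.le,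
          sq_nonneg t]
    _ ≤ _ := by gcongr

theorem exp_neg_effPotential {Sig : Set ℂ} {Δ : ℝ} {h : ℂ → ℝ} {p : ℂ} (hp : p ∈ Sig) {o : ℝ}
    (ho : obstacle (potential Sig Δ h) p = o) (b : ℝ) :
    EReal.exp (-((b : EReal) * effPotential (potential Sig Δ h) p))
      = ENNReal.ofReal (Real.exp (-(b * (Δ * ‖p‖ ^ 2 + h p - o)))) := by
  rw [effPotential, ho, potential_of_mem hp, ← EReal.coe_sub, ← EReal.coe_mul, ← EReal.coe_neg,
    EReal.exp_coe]

/-- Upper bound for the one-point function at points of `Sig`. -/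
theorem onePoint_le_exp_neg_effPotential {Sig : Set ℂ} (hS : IsCompact Sig) {Δ₀ Δ η : ℝ}
    (hΔ₀ : 0 < Δ₀) (hΔ : Δ₀ ≤ Δ) (hη : 0 < η) {h : ℂ → ℝ}
    (hh : InnerProductSpace.HarmonicOnNhd h Sig)
    (hdist : ∀ z ∈ coincidenceSet (potential Sig Δ h), ∀ w ∉ Sig, 2 * η ≤ dist z w)
    (m : ℕ) {β : ℝ} (hβ : 0 < β) {p : ℂ} (hp : p ∈ Sig) {o : ℝ}
    (ho : obstacle (potential Sig Δ h) p = o) :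
    onePoint (potential Sig Δ h) β (m + 1) p
      ≤ ENNReal.ofReal (4 / 3 * (16 + 1 / (η ^ 2 * Δ₀)) * (4 + 16 / (η ^ 2 * Δ₀)) * (1 + 1 / β)
          * Real.exp (2 * β) * ((m + 1) * Δ)
          * Real.exp (-((m + 1) * β * (Δ * ‖p‖ ^ 2 + h p - o)))) := by
  have hΔ' : 0 < Δ := hΔ₀.trans_le hΔ
  have hn : (0 : ℝ) < m + 1 := by positivity
  have hn1 : (1 : ℝ) ≤ m + 1 := by linarith [Nat.cast_nonneg (α := ℝ) m]
  set r : ℝ := 1 / (4 * Real.sqrt ((m + 1) * Δ)) with hr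
  have hsq : 0 < Real.sqrt ((m + 1) * Δ) := Real.sqrt_pos.2 (by positivity)
  have hr0 : 0 < r := by positivity
  have hrn : (m + 1) * Δ * (4 * r) ^ 2 = 1 := by
    have e : 4 * r = 1 / Real.sqrt ((m + 1) * Δ) := by rw [hr]; field_simp
    rw [e, div_pow, Real.sq_sqrt (by positivity)]
    field_simp
  -- When `n Δ` is small the microscopic radius may exceed `η`; the minimum keeps the discs inside
  -- `Sig`, and `1 / r₀²` stays of order `n Δ` because `n Δ ≥ Δ₀`.
  set r₀ := min r η with hr₀
  have hr₀0 : 0 < r₀ := lt_min hr0 hη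
  have hr₀sq : r₀ ^ 2 ≤ r ^ 2 := pow_le_pow_left₀ hr₀0.le (min_le_left _ _) 2
  have hrn₀ : (m + 1) * Δ * r₀ ^ 2 ≤ 1 := by
    calc (m + 1) * Δ * r₀ ^ 2 ≤ (m + 1) * Δ * (4 * r) ^ 2 := by
          gcongr
          nlinarith
      _ = 1 := hrn
  have hM0 : 0 ≤ 2 / β + 4 + 16 / (η ^ 2 * Δ₀) := by positivity
  refine (onePoint_le_of_expectedCount_le hS hΔ'.le hh hβ m hp ho hr₀0 hrn₀ hM0 fun w hw => ?_).trans
    (ENNReal.ofReal_le_ofReal ?_)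
  · have hball := closedBall_subset_of_two_mul_le_dist hη (hdist w hw)
    exact ⟨(Metric.closedBall_subset_closedBall (min_le_right _ _)).trans hball,
      (expectedCount_mono _ _ _ _ (min_le_left _ _)).trans
        (expectedCount_le_const hS.isClosed hΔ₀ hΔ hh hβ m hη hr0 hrn hball)⟩
  · have h1 : 1 / r₀ ^ 2 ≤ (16 + 1 / (η ^ 2 * Δ₀)) * ((m + 1) * Δ) := by
      have hrinv : 1 / r ^ 2 = 16 * ((m + 1) * Δ) := by
        rw [div_eq_iff (by positivity)]
        linarith
      have h2 : 1 / η ^ 2 ≤ 1 / (η ^ 2 * Δ₀) * ((m + 1) * Δ) := by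
        rw [div_mul_eq_mul_div, one_mul, div_le_div_iff₀ (by positivity) (by positivity), one_mul]
        calc η ^ 2 * Δ₀ = (1 * Δ₀) * η ^ 2 := by ring
          _ ≤ ((m + 1) * Δ) * η ^ 2 := by gcongr
      have hpos : 0 ≤ 1 / (η ^ 2 * Δ₀) * ((m + 1) * Δ) := by positivity
      have hpos2 : 0 ≤ 16 * ((m + 1) * Δ) := by positivity
      rcases min_cases r η with ⟨hmin, _⟩ | ⟨hmin, _⟩
      · rw [hr₀, hmin, hrinv]; linarith
      · rw [hr₀, hmin]; linarith
    have h2 : 2 / β + 4 + 16 / (η ^ 2 * Δ₀) ≤ (4 + 16 / (η ^ 2 * Δ₀)) * (1 + 1 / β) := by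
      have e : (4 + 16 / (η ^ 2 * Δ₀)) * (1 + 1 / β)
          = 4 * (1 / β) + 4 + 16 / (η ^ 2 * Δ₀) + 16 / (η ^ 2 * Δ₀) * (1 / β) := by ring
      have h3 : 0 ≤ 16 / (η ^ 2 * Δ₀) * (1 / β) := by positivity
      have h4 : 0 ≤ 1 / β := by positivity
      have h5 : 2 / β = 2 * (1 / β) := by ring
      linarith
    have h3 : 4 / (3 * r₀ ^ 2) = 4 / 3 * (1 / r₀ ^ 2) := by field_simp
    rw [h3]
    calc _ ≤ 4 / 3 * ((16 + 1 / (η ^ 2 * Δ₀)) * ((m + 1) * Δ))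
            * ((4 + 16 / (η ^ 2 * Δ₀)) * (1 + 1 / β)) * Real.exp (2 * β)
            * Real.exp (-((m + 1) * β * (Δ * ‖p‖ ^ 2 + h p - o))) := by gcongr
      _ = _ := by ring

end HeleShaw

theorem mainTheorem2 (Δ₀ η₀ : ℝ) (hΔ₀ : 0 < Δ₀) (hη₀ : 0 < η₀) :
    ∃ C : ℝ, 0 < C ∧
      ∀ (Sig : Set ℂ) (Δ : ℝ) (h : ℂ → ℝ),
        IsCompact Sig →
        HeleShaw.HasPositiveCapacity Sig →
        InnerProductSpace.HarmonicOnNhd h Sig →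
        Δ₀ ≤ Δ →
        HeleShaw.coincidenceSet (HeleShaw.potential Sig Δ h)
          = HeleShaw.droplet (HeleShaw.potential Sig Δ h) →
        (∀ z ∈ HeleShaw.droplet (HeleShaw.potential Sig Δ h), ∀ w ∉ Sig, 2 * η₀ ≤ dist z w) →
        ∀ n : ℕ, 1 ≤ n → ∀ β : ℝ, 0 < β → ∀ z : ℂ,
          HeleShaw.onePoint (HeleShaw.potential Sig Δ h) β n z
            ≤ ENNReal.ofReal (C ^ β * (1 + β ^ (-2 : ℤ)) * (n * Δ))
              * min 1 ((n : ENNReal) * EReal.exp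
                  (-(((n * β : ℝ) : EReal)
                    * HeleShaw.effPotential (HeleShaw.potential Sig Δ h) z))) := by
  set c : ℝ := 4 / 3 * (16 + 1 / (η₀ ^ 2 * Δ₀)) * (4 + 16 / (η₀ ^ 2 * Δ₀)) with hc
  have hc0 : 0 < c := by positivity
  -- In `C ^ β`, the part `2 * c` absorbs the constant `c` and the part `2` the factor `exp (2 *
  -- β)`.
  refine ⟨Real.exp (2 * c + 2), Real.exp_pos _, ?_⟩
  intro Sig Δ h hS _ hh hΔ hcoin hdist n hn β hβ p
  obtain ⟨m, rfl⟩ : ∃ m, n = m + 1 := ⟨n - 1, by omega⟩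
  have hcont := HeleShaw.continuousOn_of_harmonicOnNhd hh
  have hΔ' : 0 < Δ := hΔ₀.trans_le hΔ
  by_cases hp : p ∈ Sig
  · obtain ⟨o, ho, hoQ⟩ := HeleShaw.exists_obstacle_eq_coe (Δ := Δ) hS hcont hp
    -- The transported particle lands on the coincidence set, so the separation from the complement
    -- of `Sig` is needed there.
    rw [← hcoin] at hdist
    refine (HeleShaw.onePoint_le_exp_neg_effPotential hS hΔ₀ hΔ hη₀ hh hdist m hβ hp ho).trans ?_
    rw [HeleShaw.exp_neg_effPotential hp ho]
    push_cast
    set E := Real.exp (-((m + 1) * β * (Δ * ‖p‖ ^ 2 + h p - o)))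
    have hE1 : E ≤ 1 := by
      refine Real.exp_le_one_iff.2 (neg_nonpos.2 (mul_nonneg (by positivity) ?_))
      linarith
    rw [ENNReal.ofReal_mul (by positivity)]
    refine mul_le_mul' (ENNReal.ofReal_le_ofReal ?_) (le_min ?_ ?_)
    · have h1 := HeleShaw.mul_one_add_inv_le_exp_mul hc0.le hβ
      have h2 : Real.exp (2 * c + 2) ^ β = Real.exp (2 * c * β) * Real.exp (2 * β) := by
        rw [← Real.exp_mul, ← Real.exp_add]; congr 1; ring
      rw [h2]
      calc c * (1 + 1 / β) * Real.exp (2 * β) * ((m + 1) * Δ)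
          ≤ Real.exp (2 * c * β) * (1 + β ^ (-2 : ℤ)) * Real.exp (2 * β) * ((m + 1) * Δ) := by
            gcongr
        _ = _ := by ring
    · rw [← ENNReal.ofReal_one]
      exact ENNReal.ofReal_le_ofReal hE1
    -- The exponential bound holds without the factor `n`, which is given away here.
    · refine le_mul_of_one_le_left' ?_
      exact le_add_self
  · rw [HeleShaw.onePoint_eq_zero hS.isClosed hcont hβ m hp]
    exact zero_le
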